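/- Let $S^1=\mathbb{R}/\mathbb{Z}$ and write $|A|$ for the length of an arc $A$. A multicritical circle map is an orientation-preserving homeomorphism $f:S^1\to S^1$ of class $C^r$, $r\ge 3$, with finitely many critical points $c_0,\dots,c_{N-1}$, for which there are neighbourhoods $W_i$ of $c_i$ such that: (1) the Schwarzian derivative of $f$ is negative on $W_i\setminus\{c_i\}$; (2) there are $0<\alpha_i<\beta_i$ and $s_i>1$ with $\alpha_i|x-c_i|^{s_i-1}<f'(x)<\beta_i|x-c_i|^{s_i-1}$ for all $x\in W_i\setminus\{c_i\}$; (3) $\log f'$ has bounded variation on $S^1\setminus\bigcup_i W_i$. Let $f$ be a multicritical circle map without periodic points, and let $\rho=1/(a_0+1/(a_1+\cdots))\in(0,1)$ be its (irrational) rotation number. Put $q_0=1$, $q_1=a_0$, $q_{n+1}=a_nq_n+q_{n-1}$ for $n\ge 1$. For a critical point $c_0$ of $f$ and $n\ge 0$ let $I_n=I_n(c_0)$ be the closed arc with endpoints $c_0$ and $f^{q_n}(c_0)$ that contains $f^{q_{n+2}}(c_0)$. For $n\geq 1$, the dynamical partition $\mathcal{P}_n(c_0)$ of $S^1$ (modulo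 endpoints) consists of the long atoms $f^j(I_n)$, $0\le j<q_{n+1}$, and the short atoms $f^\ell(I_{n+1})$, $0\le \ell<q_n$. For $0\le k<a_{n+1}$ let $\Delta_k=f^{q_n+kq_{n+1}}(I_{n+1})$; these arcs tile $I_n\setminus I_{n+2}$ modulo endpoints. Let $0\le k_1<\dots<k_r<a_{n+1}$ be the indices $k$ for which $\Delta_k$ contains a critical point of $f^{q_{n+1}}$, put $k_0=0$, and define the bridges $$G_i=\bigcup_{k=k_i+1}^{k_{i+1}-1}\Delta_k\quad(0\le i<r),\qquad G_r=\bigcup_{k=k_r+1}^{a_{n+1}-1}\Delta_k ,$$ some of which may be empty. The auxiliary partition $\mathcal{P}_n^*(c_0)$, which refines $\mathcal{P}_n(c_0)$, consists of the critical spots $f^j(\Delta_{k_i})$, the non-empty bridges $f^j(G_i)$ and the arcs $f^j(I_{n+2})$, where $0\le i\le r$ and $0\le j<q_{n+1}$, together with the short atoms $f^\ell(I_{n+1})$, $0\le\ell<q_n$. Two different atoms are called consecutive if they have a common endpoint. Proposition. For every multicritical circle map $f$ without periodic points there is a constant $K>1$, depending only on $f$, such that for every critical point $c_0$ of $f$,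 every $n\ge 1$ and any two consecutive atoms $A,B$ of $\mathcal{P}_n^*(c_0)$, $$K^{-1}|B|\le |A|\le K|B| .$$ -/

import Mathlib

open MeasureTheory Topology

noncomputable section

/-- The Schwarzian derivative `(F''/F')' - (1/2) (F''/F')^2` of a real function. -/
def schwarzian (F : ℝ → ℝ) (t : ℝ) : ℝ :=
  deriv (fun u => deriv (deriv F) u / deriv F u) t
    - (1 / 2) * (deriv (deriv F) t / deriv F t) ^ 2

/-- `p` is a critical point of the circle map with lift `F`. The derivative of a lift is
periodic, so the choice of the representative `t` of `p` does not matter. -/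
def IsCircleCritical (F : ℝ → ℝ) (p : UnitAddCircle) : Prop :=
  ∃ t : ℝ, (t : UnitAddCircle) = p ∧ deriv F t = 0

/-- A multicritical circle map: an orientation-preserving homeomorphism of `ℝ / ℤ`
(that is, one that has a monotone lift `F` with `F (t + 1) = F t + 1`), of class `C^3`, with
finitely many critical points, all of them non-flat. Derivatives of the circle map are
those of the lift; none of the notions below depends on the choice of the lift. -/
structure MulticriticalCircleMap where
  toHomeomorph : UnitAddCircle ≃ₜ UnitAddCircle
  lift : CircleDeg1Lift
  coe_lift : ∀ t : ℝ, ((lift t : ℝ) : UnitAddCircle) = toHomeomorph (t : UnitAddCircle)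
  contDiff_lift : ContDiff ℝ 3 lift
  finite_critical : {c : UnitAddCircle | IsCircleCritical lift c}.Finite
  /-- Around each critical point `c` there is a neighbourhood `W c`, on which, outside `c`, the
  Schwarzian derivative is negative and the derivative obeys a power law with exponent
  `s - 1 > 0`; outside all of these neighbourhoods `log Df` has bounded variation. -/
  nonflat : ∃ W : UnitAddCircle → Set UnitAddCircle,
    (∀ c, IsCircleCritical lift c →
      W c ∈ 𝓝 c ∧
      (∀ t : ℝ, (t : UnitAddCircle) ∈ W c → (t : UnitAddCircle) ≠ c → schwarzian lift t < 0) ∧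
      ∃ α β s : ℝ, 0 < α ∧ α < β ∧ 1 < s ∧
        ∀ t : ℝ, (t : UnitAddCircle) ∈ W c → (t : UnitAddCircle) ≠ c →
          α * ‖(t : UnitAddCircle) - c‖ ^ (s - 1) < deriv lift t ∧
          deriv lift t < β * ‖(t : UnitAddCircle) - c‖ ^ (s - 1)) ∧
    ∃ V : ℝ, 0 < V ∧
      eVariationOn (fun t => Real.log (deriv lift t))
        {t : ℝ | t ∈ Set.Icc (0 : ℝ) 1 ∧
          ∀ c, IsCircleCritical lift c → (t : UnitAddCircle) ∉ W c} ≤ ENNReal.ofReal V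

namespace MulticriticalCircleMap

variable (f : MulticriticalCircleMap)

/-- The `m`-th iterate of `f`. -/
def iter (m : ℕ) : UnitAddCircle → UnitAddCircle := f.toHomeomorph^[m]

/-- `p` is a critical point of the `m`-th iterate of `f`. -/
def IsCriticalIter (m : ℕ) (p : UnitAddCircle) : Prop := IsCircleCritical (f.lift^[m]) p

/-- The rotation number of `f`, as a number in `[0, 1)`. -/
def rotationNumber : ℝ := Int.fract (CircleDeg1Lift.translationNumber f.lift)

/-- The partial quotients in `ρ = 1 / (a₀ + 1 / (a₁ + ⋯))`, where `ρ` is the rotation number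
(used only for irrational `ρ`, when all of them exist and are positive integers). -/
def a (n : ℕ) : ℕ := ⌊((GenContFract.of f.rotationNumber).partDens.get? n).getD 0⌋₊

/-- The return times `q₀ = 1`, `q₁ = a₀`, `q_{n+2} = a_{n+1} q_{n+1} + q_n`. -/
def q : ℕ → ℕ
  | 0 => 1
  | 1 => f.a 0
  | n + 2 => f.a (n + 1) * q (n + 1) + q n

open Classical in
/-- `I_n(x)`: the closed arc with endpoints `x` and `f^{q_n}(x)` that contains `f^{q_{n+2}}(x)`.
(`Set.cIcc x y` is the closed arc from `x` to `y` in the positive direction.) -/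
def I (n : ℕ) (x : UnitAddCircle) : Set UnitAddCircle :=
  if f.iter (f.q (n + 2)) x ∈ Set.cIcc x (f.iter (f.q n) x) then
    Set.cIcc x (f.iter (f.q n) x)
  else
    Set.cIcc (f.iter (f.q n) x) x

/-- `Δ_k = f^{q_n + k q_{n+1}}(I_{n+1}(x))`; for `k < a_{n+1}` these arcs tile
`I_n(x) \ I_{n+2}(x)`. -/
def Delta (n : ℕ) (x : UnitAddCircle) (k : ℕ) : Set UnitAddCircle :=
  f.iter (f.q n + k * f.q (n + 1)) '' f.I (n + 1) x

/-- The critical times `k_0, …, k_r` at level `n`: `k_0 = 0`, together with all `k < a_{n+1}` such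
that `Δ_k` contains a critical point of `f^{q_{n+1}}`. -/
def criticalTimes (n : ℕ) (x : UnitAddCircle) : Set ℕ :=
  {k | k < f.a (n + 1) ∧
    (k = 0 ∨ ∃ p ∈ f.Delta n x k, f.IsCriticalIter (f.q (n + 1)) p)}

/-- The primary critical spots `Δ_{k_i}`. -/
def criticalSpots (n : ℕ) (x : UnitAddCircle) : Set (Set UnitAddCircle) :=
  {A | ∃ k ∈ f.criticalTimes n x, A = f.Delta n x k}

/-- The non-empty primary bridges `G_i`: the union of the `Δ_m` with `k < m < k'`, where `k` is a
critical time and `k'` is the next critical time, or `a_{n+1}` if `k` is the last one. -/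
def bridges (n : ℕ) (x : UnitAddCircle) : Set (Set UnitAddCircle) :=
  {A | A.Nonempty ∧ ∃ k ∈ f.criticalTimes n x, ∃ k' : ℕ,
    (k' ∈ f.criticalTimes n x ∨ k' = f.a (n + 1)) ∧ k < k' ∧
    (∀ m, k < m → m < k' → m ∉ f.criticalTimes n x) ∧
    A = ⋃ m ∈ Set.Ioo k k', f.Delta n x m}

/-- The auxiliary partition `P*_n(x)` of the circle (modulo endpoints). Each long atom
`f^j(I_n(x))`, `0 ≤ j < q_{n+1}`, of the dynamical partition `P_n(x)` is split into the `f^j`-images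
of the critical spots, the non-empty bridges and `I_{n+2}(x)`; the short atoms
`f^l(I_{n+1}(x))`, `0 ≤ l < q_n`, are kept. -/
def auxPartition (n : ℕ) (x : UnitAddCircle) : Set (Set UnitAddCircle) :=
  {A | ∃ j < f.q (n + 1), ∃ B ∈ f.criticalSpots n x, A = f.iter j '' B} ∪
  {A | ∃ j < f.q (n + 1), ∃ B ∈ f.bridges n x, A = f.iter j '' B} ∪
  {A | ∃ j < f.q (n + 1), A = f.iter j '' f.I (n + 2) x} ∪
  {A | ∃ l < f.q n, A = f.iter l '' f.I (n + 1) x}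

end MulticriticalCircleMap

/-- Two atoms of a partition of the circle into closed arcs (modulo endpoints) are consecutive
when they are different and have a common point, which is then a common endpoint. -/
def ConsecutiveAtoms (A B : Set UnitAddCircle) : Prop := A ≠ B ∧ (A ∩ B).Nonempty

/-- The length of an arc of `ℝ / ℤ` (the whole circle has length `1`). -/
def arcLength (A : Set UnitAddCircle) : ℝ := (volume A).toReal

end

/-! The proof rests on the fact that cross-ratios of four points cannot grow much under long
iteration. Near a critical point the negative Schwarzian derivative keeps the cross-ratio from
growing if the hull of the four points avoids that point. Elsewhere a short hull without critical
points costs a factor exp(O(length)). Any remaining hull costs a bounded factor, because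
non-flatness bounds the derivative by a multiple of its average. All cases take the form exp(K
μ(hull)), where μ is Lebesgue measure plus a unit mass at each critical point
(`exists_crossRatio_lift_le_exp_measure`). Let σₙ be the lift of f^{±qₙ} that moves points slightly
to the right. By best approximation the first qₙ₊₁ images of [x, σₙ x) are disjoint on the circle,
so the exponents add up to a bound independent of n (`exists_crossRatio_iterate_le`).

Consequently lower bounds for cross-ratios of images pull back. Near a shortest interval [z, σₙ z]
there are two adjacent fundamental intervals comparable to it. Every point enters them within 2qₙ₊₁
iterates, so adjacent fundamental intervals are comparable everywhere (`exists_gap_le`). At a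
critical point the levels n and n + 1 are also comparable: otherwise the first iterate would shrink
their ratio so strongly that the remaining iterates of the return, which ends close to the critical
point, could not restore it (`exists_gap_le_gap_succ_of_critical`). Pulling back extends this to all
points that come close to a critical point within 2qₙ₊₁ iterates
(`exists_gap_le_gap_succ_of_near_critical`).

Every atom of P*ₙ therefore lies in two adjacent fundamental intervals of level n and is comparable
to them (`exists_isLargeAtom`): critical spots and short atoms because their orbits pass by a
critical point, images of Iₙ₊₂ by descending two levels, and bridges because they contain an arc Δ
adjacent to a critical spot. Two atoms that meet lie among neighbouring fundamental intervals, hence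
are comparable (`exists_arcLength_le`). -/

noncomputable section

/-! ### Cross-ratios and the Schwarzian derivative on the line -/

/-- The cross-ratio `|L||R| / (|L ∪ M||M ∪ R|)` of `L = [a,b]`, `M = [b,c]`, `R = [c,d]`. -/
def crossRatio (a b c d : ℝ) : ℝ := (b - a) * (d - c) / ((c - a) * (d - b))

lemma crossRatio_nonneg {a b c d : ℝ} (hab : a < b) (hbc : b < c) (hcd : c < d) :
    0 ≤ crossRatio a b c d :=
  div_nonneg (mul_nonneg (by linarith) (by linarith)) (mul_nonneg (by linarith) (by linarith))

lemma crossRatio_eq_mul (a b c d : ℝ) :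
    crossRatio a b c d = (b - a) / (c - a) * ((d - c) / (d - b)) := by
  rw [crossRatio, mul_div_mul_comm]

lemma crossRatio_le_left {a b c d : ℝ} (hab : a < b) (hbc : b < c) (hcd : c < d) :
    crossRatio a b c d ≤ (b - a) / (c - a) := by
  rw [crossRatio_eq_mul]
  refine mul_le_of_le_one_right (div_nonneg (by linarith) (by linarith)) ?_
  rw [div_le_one (by linarith)]; linarith

lemma crossRatio_le_right {a b c d : ℝ} (hab : a < b) (hbc : b < c) (hcd : c < d) :
    crossRatio a b c d ≤ (d - c) / (d - b) := by
  rw [crossRatio_eq_mul]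
  refine mul_le_of_le_one_left (div_nonneg (by linarith) (by linarith)) ?_
  rw [div_le_one (by linarith)]; linarith

/-- If average slopes on end intervals are at most `C` times the average slope on a larger
interval, then cross-ratios are distorted by at most `C ^ 2`. -/
lemma crossRatio_le_of_slope {F : ℝ → ℝ} (hF : StrictMono F) {C a b c d : ℝ} (hC : 0 ≤ C)
    (hab : a < b) (hbc : b < c) (hcd : c < d)
    (h₁ : (F b - F a) * (c - a) ≤ C * ((b - a) * (F c - F a)))
    (h₂ : (F d - F c) * (d - b) ≤ C * ((d - c) * (F d - F b))) :
    crossRatio (F a) (F b) (F c) (F d) ≤ C ^ 2 * crossRatio a b c d := by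
  have e1 := hF hab
  have e2 := hF hbc
  have e3 := hF hcd
  rw [crossRatio_eq_mul, crossRatio_eq_mul]
  have k1 : (F b - F a) / (F c - F a) ≤ C * ((b - a) / (c - a)) := by
    rw [← mul_div_assoc, div_le_div_iff₀ (by linarith) (by linarith)]; linarith
  have k2 : (F d - F c) / (F d - F b) ≤ C * ((d - c) / (d - b)) := by
    rw [← mul_div_assoc, div_le_div_iff₀ (by linarith) (by linarith)]; linarith
  calc _ ≤ (C * ((b - a) / (c - a))) * (C * ((d - c) / (d - b))) :=
        mul_le_mul k1 k2 (div_nonneg (by linarith) (by linarith))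
          (mul_nonneg hC (div_nonneg (by linarith) (by linarith)))
    _ = _ := by ring

/-- A function with derivative at most `C` times the average slope. -/
lemma slope_le_of_deriv_le {F : ℝ → ℝ} (hF : Differentiable ℝ F) {C a d x y : ℝ}
    (hax : a ≤ x) (hxy : x < y) (hyd : y ≤ d)
    (h : ∀ t ∈ Set.Icc a d, deriv F t * (d - a) ≤ C * (F d - F a)) :
    (F y - F x) * (d - a) ≤ C * ((y - x) * (F d - F a)) := by
  obtain ⟨t, ht, e⟩ := exists_deriv_eq_slope F hxy hF.continuous.continuousOn
    hF.differentiableOn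
  have := h t ⟨hax.trans ht.1.le, ht.2.le.trans hyd⟩
  have hp : 0 < y - x := by linarith
  have e' : F y - F x = deriv F t * (y - x) := by rw [e]; field_simp
  rw [e']
  nlinarith [mul_le_mul_of_nonneg_right this hp.le]

/-- By the mean value theorem an average slope is a value of the derivative, so bounded distortion
of `F'` supplies both slope hypotheses of `crossRatio_le_of_slope`. This serves the intervals away
from the critical points. -/
lemma crossRatio_le_of_deriv_le {F : ℝ → ℝ} (hF : StrictMono F) (hd : Differentiable ℝ F)
    {C a b c d : ℝ} (hC : 0 ≤ C) (hab : a < b) (hbc : b < c) (hcd : c < d)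
    (h : ∀ x ∈ Set.Icc a d, ∀ y ∈ Set.Icc a d, deriv F x ≤ C * deriv F y) :
    crossRatio (F a) (F b) (F c) (F d) ≤ C ^ 2 * crossRatio a b c d := by
  have key : ∀ u v, a ≤ u → u < v → v ≤ d →
      ∀ t ∈ Set.Icc u v, deriv F t * (v - u) ≤ C * (F v - F u) := by
    intro u v hu huv hv t ht
    obtain ⟨s, hs, e⟩ := exists_deriv_eq_slope F huv hd.continuous.continuousOn
      hd.differentiableOn
    have hp : 0 < v - u := by linarith
    have e' : F v - F u = deriv F s * (v - u) := by rw [e]; field_simp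
    have := h t ⟨hu.trans ht.1, ht.2.trans hv⟩ s ⟨hu.trans hs.1.le, hs.2.le.trans hv⟩
    rw [e']
    nlinarith [mul_le_mul_of_nonneg_right this hp.le]
  exact crossRatio_le_of_slope hF hC hab hbc hcd
    (slope_le_of_deriv_le hd le_rfl hab hbc.le (key a c le_rfl (hab.trans hbc) hcd.le))
    (slope_le_of_deriv_le hd hbc.le hcd le_rfl (key b d hab.le (hbc.trans hcd) le_rfl))

/-- For nonpositive Schwarzian derivative the function `(F')^(-1/2)` is convex. -/
lemma convexOn_of_schwarzian_nonpos {F : ℝ → ℝ} (hF : ContDiff ℝ 3 F) {a d : ℝ}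
    (hpos : ∀ t ∈ Set.Icc a d, 0 < deriv F t) (hS : ∀ t ∈ Set.Icc a d, schwarzian F t ≤ 0) :
    ConvexOn ℝ (Set.Icc a d) (fun t => Real.exp (-(1 / 2) * Real.log (deriv F t))) := by
  have h1 : ContDiff ℝ 2 (deriv F) := ((contDiff_succ_iff_deriv (n := 2)).1 hF).2.2
  have h2 : ContDiff ℝ 1 (deriv (deriv F)) := ((contDiff_succ_iff_deriv (n := 1)).1 h1).2.2
  have d1 : Differentiable ℝ (deriv F) := h1.differentiable (by norm_num)
  have d2 : Differentiable ℝ (deriv (deriv F)) := h2.differentiable (by norm_num)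
  set N : ℝ → ℝ := fun u => deriv (deriv F) u / deriv F u with hN
  set φ : ℝ → ℝ := fun t => Real.exp (-(1 / 2) * Real.log (deriv F t)) with hφ
  have hφ' : ∀ t ∈ Set.Icc a d, HasDerivAt φ (φ t * (-(1 / 2) * N t)) t := fun t ht =>
    (((d1 t).hasDerivAt.log (hpos t ht).ne').const_mul (-(1 / 2))).exp
  have hN' : ∀ t ∈ Set.Icc a d, HasDerivAt N (deriv N t) t := fun t ht =>
    ((d2 t).div (d1 t) (hpos t ht).ne').hasDerivAt
  -- With N = F''/F' one has φ' = -φN/2 and φ'' = φ(N²/4 - N'/2), which is -φ/2 times the Schwarzian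
  -- derivative.
  refine convexOn_of_hasDerivWithinAt2_nonneg (convex_Icc a d)
    (f' := fun t => φ t * (-(1 / 2) * N t))
    (f'' := fun t => φ t * (-(1 / 2) * N t) * (-(1 / 2) * N t) + φ t * (-(1 / 2) * deriv N t))
    (fun t ht => (hφ' t ht).continuousAt.continuousWithinAt)
    (fun t ht => (hφ' t (interior_subset ht)).hasDerivWithinAt)
    (fun t ht => ?_) (fun t ht => ?_)
  · have ht := interior_subset ht
    exact ((hφ' t ht).mul ((hN' t ht).const_mul (-(1 / 2)))).hasDerivWithinAt
  · have := hS t (interior_subset ht)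
    rw [schwarzian] at this
    have hp : 0 < φ t := Real.exp_pos _
    change deriv N t - 1 / 2 * N t ^ 2 ≤ 0 at this
    nlinarith [mul_nonneg hp.le (sub_nonneg.2 this)]

/-- For nonpositive Schwarzian derivative, the geometric mean of the end-point derivatives is at
most the average slope. -/
lemma deriv_mul_deriv_le_of_schwarzian_nonpos {F : ℝ → ℝ} (hF : ContDiff ℝ 3 F) {x y : ℝ}
    (hxy : x < y) (hpos : ∀ t ∈ Set.Icc x y, 0 < deriv F t)
    (hS : ∀ t ∈ Set.Icc x y, schwarzian F t ≤ 0) :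
    deriv F x * deriv F y * (y - x) ^ 2 ≤ (F y - F x) ^ 2 := by
  have hconv := convexOn_of_schwarzian_nonpos hF hpos hS
  set φ : ℝ → ℝ := fun t => Real.exp (-(1 / 2) * Real.log (deriv F t)) with hφ
  have hφp : ∀ t, 0 < φ t := fun t => Real.exp_pos _
  have hsq : ∀ t ∈ Set.Icc x y, deriv F t * φ t ^ 2 = 1 := by
    intro t ht
    rw [hφ]; simp only
    rw [← Real.exp_nat_mul, ← Real.exp_log (hpos t ht), Real.log_exp, ← Real.exp_add]
    rw [Real.exp_eq_one_iff]; push_cast; ring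
  have hd : 0 < y - x := by linarith
  set m : ℝ := (φ y - φ x) / (y - x) with hm
  -- `l` is the chord of the convex function φ. The Möbius map (t - x)/(φ(x) l(t)) has derivative
  -- l⁻², which is at most φ⁻² = F', so it grows more slowly than F on [x, y].
  set l : ℝ → ℝ := fun t => φ x + m * (t - x) with hl
  have hlle : ∀ t ∈ Set.Icc x y, φ t ≤ l t := by
    intro t ht
    have := hconv.2 (Set.left_mem_Icc.2 hxy.le) (Set.right_mem_Icc.2 hxy.le)
      (show 0 ≤ (y - t) / (y - x) from div_nonneg (by linarith [ht.2]) hd.le)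
      (show 0 ≤ (t - x) / (y - x) from div_nonneg (by linarith [ht.1]) hd.le)
      (by field_simp; ring)
    have e : ((y - t) / (y - x)) • x + ((t - x) / (y - x)) • y = t := by
      simp only [smul_eq_mul]; field_simp; ring
    rw [e] at this
    refine this.trans (le_of_eq ?_)
    simp only [smul_eq_mul, hl, hm]; field_simp; ring
  have hlp : ∀ t ∈ Set.Icc x y, 0 < l t := fun t ht => (hφp t).trans_le (hlle t ht)
  have hly : l y = φ y := by simp only [hl, hm]; field_simp; ring
  have dF : Differentiable ℝ F := hF.differentiable (by norm_num)
  have hder : ∀ t ∈ Set.Icc x y,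
      HasDerivAt (fun t => F t - (t - x) / (φ x * l t)) (deriv F t - 1 / l t ^ 2) t := by
    intro t ht
    have h1 : HasDerivAt l m t := by
      exact ((((hasDerivAt_id t).sub_const x).const_mul m).const_add (φ x)).congr_deriv (by simp)
    have h2 := (((hasDerivAt_id t).sub_const x).div (h1.const_mul (φ x))
      (mul_pos (hφp x) (hlp t ht)).ne')
    refine ((dF t).hasDerivAt.sub h2).congr_deriv ?_
    have h3 := (hlp t ht).ne'
    have h4 := (hφp x).ne'
    congr 1
    rw [div_eq_div_iff (by positivity) (by positivity)]
    simp only [id, hl]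
    ring
  have hmono : MonotoneOn (fun t => F t - (t - x) / (φ x * l t)) (Set.Icc x y) := by
    refine monotoneOn_of_deriv_nonneg (convex_Icc x y)
      (fun t ht => (hder t ht).continuousAt.continuousWithinAt)
      (fun t ht => (hder t (interior_subset ht)).differentiableAt.differentiableWithinAt)
      (fun t ht => ?_)
    have ht := interior_subset ht
    rw [(hder t ht).deriv]
    have h1 := hsq t ht
    have h2 := hlle t ht
    have h3 := hφp t
    have h4 : deriv F t = 1 / φ t ^ 2 := by field_simp; linarith
    rw [h4, sub_nonneg]
    exact one_div_le_one_div_of_le (by positivity) (by gcongr)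
  have := hmono (Set.left_mem_Icc.2 hxy.le) (Set.right_mem_Icc.2 hxy.le) hxy.le
  simp only [sub_self, zero_div, sub_zero, hly] at this
  have hle : (y - x) / (φ x * φ y) ≤ F y - F x := by linarith
  have h5 : deriv F x * deriv F y * (y - x) ^ 2 = ((y - x) / (φ x * φ y)) ^ 2 := by
    have e1 := hsq x (Set.left_mem_Icc.2 hxy.le)
    have e2 := hsq y (Set.right_mem_Icc.2 hxy.le)
    have := hφp x
    have := hφp y
    rw [div_pow, eq_div_iff (by positivity)]
    calc _ = (deriv F x * φ x ^ 2) * (deriv F y * φ y ^ 2) * (y - x) ^ 2 := by ring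
      _ = _ := by rw [e1, e2]; ring
  rw [h5]
  have := hφp x
  have := hφp y
  gcongr

/-- Maps with nonpositive Schwarzian derivative do not increase cross-ratios. -/
lemma crossRatio_le_of_schwarzian_nonpos {F : ℝ → ℝ} (hmF : StrictMono F) (hF : ContDiff ℝ 3 F)
    {a b c d : ℝ} (hab : a < b) (hbc : b < c) (hcd : c < d)
    (hpos : ∀ t ∈ Set.Icc a d, 0 < deriv F t) (hS : ∀ t ∈ Set.Icc a d, schwarzian F t ≤ 0) :
    crossRatio (F a) (F b) (F c) (F d) ≤ crossRatio a b c d := by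
  have dF : Differentiable ℝ F := hF.differentiable (by norm_num)
  -- The bound F'(x)F'(y)/(F y - F x)² ≤ 1/(y - x)² compares mixed second derivatives of log(F y - F
  -- x) and log(y - x). Here it is integrated over x in [a, b]; the integration over y in [c, d]
  -- follows.
  have key : ∀ y ∈ Set.Icc c d, deriv F y / (F y - F b) - 1 / (y - b) ≤
      deriv F y / (F y - F a) - 1 / (y - a) := by
    intro y hy
    have hby : b < y := hbc.trans_le hy.1
    have hder : ∀ x ∈ Set.Icc a b, HasDerivAt (fun x => deriv F y / (F y - F x) - 1 / (y - x))
        (deriv F y * deriv F x / (F y - F x) ^ 2 - 1 / (y - x) ^ 2) x := by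
      intro x hx
      have hxy : x < y := hx.2.trans_lt hby
      have e1 : F y - F x ≠ 0 := (sub_pos.2 (hmF hxy)).ne'
      have e2 : y - x ≠ 0 := (sub_pos.2 hxy).ne'
      have h1 := (hasDerivAt_const x (deriv F y)).div ((dF x).hasDerivAt.const_sub (F y)) e1
      have h2 := (hasDerivAt_const x (1 : ℝ)).div ((hasDerivAt_id x).const_sub y) e2
      refine (h1.sub h2).congr_deriv ?_
      simp
    have hanti : AntitoneOn (fun x => deriv F y / (F y - F x) - 1 / (y - x)) (Set.Icc a b) := by
      refine antitoneOn_of_deriv_nonpos (convex_Icc a b)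
        (fun t ht => (hder t ht).continuousAt.continuousWithinAt)
        (fun t ht => (hder t (interior_subset ht)).differentiableAt.differentiableWithinAt)
        (fun x hx => ?_)
      have hx := interior_subset hx
      have hxy : x < y := hx.2.trans_lt hby
      rw [(hder x hx).deriv, sub_nonpos,
        div_le_div_iff₀ (pow_pos (sub_pos.2 (hmF hxy)) 2) (pow_pos (sub_pos.2 hxy) 2)]
      have := deriv_mul_deriv_le_of_schwarzian_nonpos hF hxy
        (fun t ht => hpos t ⟨hx.1.trans ht.1, ht.2.trans hy.2⟩)
        (fun t ht => hS t ⟨hx.1.trans ht.1, ht.2.trans hy.2⟩)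
      linarith
    exact hanti (Set.left_mem_Icc.2 hab.le) (Set.right_mem_Icc.2 hab.le) hab.le
  have hder : ∀ y ∈ Set.Icc c d, HasDerivAt (fun y => (Real.log (F y - F a) - Real.log (y - a)) -
      (Real.log (F y - F b) - Real.log (y - b)))
      ((deriv F y / (F y - F a) - 1 / (y - a)) - (deriv F y / (F y - F b) - 1 / (y - b))) y := by
    intro y hy
    have hby : b < y := hbc.trans_le hy.1
    have hay := hab.trans hby
    exact ((((dF y).hasDerivAt.sub_const _).log (sub_pos.2 (hmF hay)).ne').sub
      (((hasDerivAt_id y).sub_const _).log (sub_pos.2 hay).ne')).sub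
      ((((dF y).hasDerivAt.sub_const _).log (sub_pos.2 (hmF hby)).ne').sub
      (((hasDerivAt_id y).sub_const _).log (sub_pos.2 hby).ne'))
  have hmono := monotoneOn_of_deriv_nonneg (convex_Icc c d)
        (fun t ht => (hder t ht).continuousAt.continuousWithinAt)
        (fun t ht => (hder t (interior_subset ht)).differentiableAt.differentiableWithinAt)
        (fun y hy => by
          have hy := interior_subset hy
          rw [(hder y hy).deriv]
          linarith [key y hy])
  have hlog := hmono (Set.left_mem_Icc.2 hcd.le) (Set.right_mem_Icc.2 hcd.le) hcd.le
  simp only at hlog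
  have pab := sub_pos.2 hab
  have pbc := sub_pos.2 hbc
  have pcd := sub_pos.2 hcd
  have qab := sub_pos.2 (hmF hab)
  have qbc := sub_pos.2 (hmF hbc)
  have qcd := sub_pos.2 (hmF hcd)
  have pac : 0 < c - a := by linarith
  have pbd : 0 < d - b := by linarith
  have pad : 0 < d - a := by linarith
  have qac : 0 < F c - F a := by linarith
  have qbd : 0 < F d - F b := by linarith
  have qad : 0 < F d - F a := by linarith
  -- This inequality says that (c - b)(d - a)/((c - a)(d - b)) does not decrease under F. That
  -- quantity equals 1 - `crossRatio a b c d`.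
  have hlog2 : Real.log ((F c - F a) * (F d - F b) * ((d - a) * (c - b))) ≤
      Real.log ((F d - F a) * (F c - F b) * ((c - a) * (d - b))) := by
    rw [Real.log_mul (by positivity) (by positivity), Real.log_mul (by positivity) (by positivity),
      Real.log_mul (by positivity) (by positivity), Real.log_mul (by positivity) (by positivity),
      Real.log_mul (by positivity) (by positivity), Real.log_mul (by positivity) (by positivity)]
    linarith
  have hfin := (Real.log_le_log_iff (by positivity) (by positivity)).1 hlog2
  rw [crossRatio, crossRatio, div_le_div_iff₀ (by positivity) (by positivity)]
  nlinarith

/-! ### Lengths of arcs and uniformity of local estimates -/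

section Arcs

lemma exists_int_of_coe_eq {s t : ℝ} (h : (s : UnitAddCircle) = t) : ∃ k : ℤ, t = s + k := by
  obtain ⟨k, hk⟩ := AddSubgroup.mem_zmultiples_iff.1 (QuotientAddGroup.eq.1 h)
  refine ⟨k, ?_⟩
  simp only [zsmul_eq_mul, mul_one] at hk
  linarith

lemma measurableSet_coe_image_Icc (a b : ℝ) :
    MeasurableSet ((fun t : ℝ => (t : UnitAddCircle)) '' Set.Icc a b) :=
  (isCompact_Icc.image (AddCircle.continuous_mk' 1)).isClosed.measurableSet

lemma arcLength_le_one (A : Set UnitAddCircle) : arcLength A ≤ 1 := by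
  have h : volume A ≤ 1 := by
    refine (measure_mono (Set.subset_univ A)).trans ?_
    rw [UnitAddCircle.measure_univ]
  exact ENNReal.toReal_le_of_le_ofReal zero_le_one (by simpa using h)

lemma arcLength_mono {A B : Set UnitAddCircle} (h : A ⊆ B) : arcLength A ≤ arcLength B :=
  ENNReal.toReal_mono (measure_ne_top _ _) (measure_mono h)

lemma volume_coe_image_Icc_eq (a b : ℝ) :
    volume ((fun t : ℝ => (t : UnitAddCircle)) '' Set.Icc a b) =
      volume ((fun t : ℝ => (t : UnitAddCircle)) ⁻¹'
        ((fun t : ℝ => (t : UnitAddCircle)) '' Set.Icc a b) ∩ Set.Ioc a (a + 1)) := by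
  rw [← (UnitAddCircle.measurePreserving_mk a).measure_preimage
    (measurableSet_coe_image_Icc a b).nullMeasurableSet, Measure.restrict_apply]
  exact (UnitAddCircle.measurePreserving_mk a).measurable (measurableSet_coe_image_Icc a b)

lemma arcLength_coe_image_Icc_le {a b : ℝ} (hab : a ≤ b) :
    arcLength ((fun t : ℝ => (t : UnitAddCircle)) '' Set.Icc a b) ≤ b - a := by
  rcases le_or_gt 1 (b - a) with h | h
  · exact (arcLength_le_one _).trans h
  refine ENNReal.toReal_le_of_le_ofReal (by linarith) ?_
  rw [volume_coe_image_Icc_eq]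
  calc _ ≤ volume (Set.Ioc a b ∪ {a + 1}) := by
        refine measure_mono ?_
        rintro t ⟨⟨s, hs, hst⟩, ht⟩
        rcases ht.2.eq_or_lt with rfl | ht2
        · exact Or.inr rfl
        · left
          have := (AddCircle.coe_eq_coe_iff_of_mem_Ico (p := (1 : ℝ)) (a := a)
            ⟨hs.1, by linarith [hs.2]⟩ ⟨ht.1.le, ht2⟩).1 hst
          exact ⟨ht.1, this ▸ hs.2⟩
    _ ≤ volume (Set.Ioc a b) + volume {a + 1} := measure_union_le _ _
    _ = _ := by simp

lemma le_arcLength_coe_image_Icc {a b : ℝ} (hb : b ≤ a + 1) :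
    b - a ≤ arcLength ((fun t : ℝ => (t : UnitAddCircle)) '' Set.Icc a b) := by
  refine (ENNReal.ofReal_le_iff_le_toReal (measure_ne_top _ _)).1 ?_
  rw [volume_coe_image_Icc_eq, ← Real.volume_Ioc]
  refine measure_mono fun t ht => ⟨⟨t, ⟨ht.1.le, ht.2⟩, rfl⟩, ht.1, ht.2.trans hb⟩

end Arcs

/-- Compactness and periodicity make a local property of short intervals uniform. -/
lemma exists_uniform_scale {Q : ℝ → ℝ → ℝ → Prop}
    (hmono : ∀ C C' a d, C ≤ C' → Q C a d → Q C' a d)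
    (hper : ∀ C a d, ∀ k : ℤ, Q C a d → Q C (a + k) (d + k))
    (hloc : ∀ x : ℝ, ∃ r > 0, ∃ C, ∀ a d, x - r < a → a < d → d < x + r → Q C a d) :
    ∃ δ > 0, ∃ C, ∀ a d, a < d → d < a + δ → Q C a d := by
  have key : ∃ δ > 0, ∃ C, ∀ a ∈ Set.Icc (0 : ℝ) 1, ∀ d, a < d → d < a + δ → Q C a d := by
    refine isCompact_Icc.induction_on (s := Set.Icc (0 : ℝ) 1)
      (p := fun S => ∃ δ > 0, ∃ C, ∀ a ∈ S, ∀ d, a < d → d < a + δ → Q C a d) ?_ ?_ ?_ ?_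
    · exact ⟨1, one_pos, 0, fun a ha => ha.elim⟩
    · rintro S T hST ⟨δ, hδ, C, h⟩
      exact ⟨δ, hδ, C, fun a ha => h a (hST ha)⟩
    · rintro S T ⟨δ, hδ, C, h⟩ ⟨δ', hδ', C', h'⟩
      refine ⟨min δ δ', lt_min hδ hδ', max C C', fun a ha d had hd => ?_⟩
      rcases ha with ha | ha
      · exact hmono _ _ _ _ (le_max_left _ _)
          (h a ha d had (hd.trans_le (by gcongr; exact min_le_left _ _)))
      · exact hmono _ _ _ _ (le_max_right _ _)
          (h' a ha d had (hd.trans_le (by gcongr; exact min_le_right _ _)))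
    · intro x _
      obtain ⟨r, hr, C, h⟩ := hloc x
      refine ⟨Set.Ioo (x - r / 2) (x + r / 2), mem_nhdsWithin_of_mem_nhds
        (Ioo_mem_nhds (by linarith) (by linarith)), r / 2, by linarith, C, fun a ha d had hd => ?_⟩
      exact h a d (by linarith [ha.1]) had (by linarith [ha.2])
  obtain ⟨δ, hδ, C, h⟩ := key
  refine ⟨δ, hδ, C, fun a d had hd => ?_⟩
  have := hper C _ _ ⌊a⌋ (h (Int.fract a) ⟨Int.fract_nonneg a, (Int.fract_lt_one a).le⟩
    (d - ⌊a⌋) (by rw [Int.fract]; linarith) (by rw [Int.fract]; linarith))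
  rwa [Int.fract_add_floor, sub_add_cancel] at this

/-! ### One-step estimates for the lift -/

namespace MulticriticalCircleMap

variable (f : MulticriticalCircleMap)

lemma differentiable_lift : Differentiable ℝ f.lift :=
  f.contDiff_lift.differentiable (by norm_num)

lemma continuous_lift : Continuous f.lift := f.contDiff_lift.continuous

lemma continuous_deriv_lift : Continuous (deriv f.lift) :=
  f.contDiff_lift.continuous_deriv (by norm_num)

/-- An interval on which the lift is constant can be shortened to length at most 1/2. There the
projection to the circle is injective, which contradicts injectivity of the homeomorphism. -/
lemma strictMono_lift : StrictMono f.lift := by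
  refine f.lift.monotone.strictMono_of_injective ?_
  have key : ∀ x y : ℝ, x < y → f.lift x ≠ f.lift y := by
    intro x y hxy h
    obtain ⟨z, hz⟩ : ∃ z, z = min y (x + 1 / 2) := ⟨_, rfl⟩
    have hxz : x < z := by rw [hz]; exact lt_min hxy (by linarith)
    have hzy : z ≤ y := hz ▸ min_le_left _ _
    have hz2 : z ≤ x + 1 / 2 := hz ▸ min_le_right _ _
    have e : f.lift x = f.lift z :=
      le_antisymm (f.lift.monotone hxz.le) (h ▸ f.lift.monotone hzy)
    have e2 : (x : UnitAddCircle) = z := by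
      apply f.toHomeomorph.injective
      rw [← f.coe_lift, ← f.coe_lift, e]
    have := (AddCircle.coe_eq_coe_iff_of_mem_Ico (p := (1 : ℝ)) (a := x)
      ⟨le_rfl, by linarith⟩ ⟨hxz.le, by linarith⟩).1 e2
    linarith
  intro x y h
  rcases lt_trichotomy x y with hxy | hxy | hxy
  · exact (key x y hxy h).elim
  · exact hxy
  · exact (key y x hxy h.symm).elim

lemma deriv_lift_nonneg (t : ℝ) : 0 ≤ deriv f.lift t := f.lift.monotone.deriv_nonneg

lemma deriv_lift_add_int (t : ℝ) (k : ℤ) : deriv f.lift (t + k) = deriv f.lift t := by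
  have h : (fun x : ℝ => f.lift (x + k)) = fun x => f.lift x + k := by
    funext x; exact f.lift.map_add_int x k
  have h2 := congrArg (fun g => deriv g t) h
  simp only [deriv_add_const, deriv_comp_add_const] at h2
  exact h2

lemma deriv_lift_eq_of_coe_eq {s t : ℝ} (h : (s : UnitAddCircle) = t) :
    deriv f.lift s = deriv f.lift t := by
  obtain ⟨k, rfl⟩ := exists_int_of_coe_eq h
  rw [deriv_lift_add_int]

lemma isCircleCritical_coe {t : ℝ} :
    IsCircleCritical f.lift (t : UnitAddCircle) ↔ deriv f.lift t = 0 := by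
  constructor
  · rintro ⟨s, hs, h⟩
    rw [← f.deriv_lift_eq_of_coe_eq hs, h]
  · exact fun h => ⟨t, rfl, h⟩

/-- The non-flatness condition in a real neighbourhood of a critical point of the lift. -/
lemma exists_nonflat_lift {c : UnitAddCircle} (hc : IsCircleCritical f.lift c) :
    ∃ r > 0, r ≤ 1 / 2 ∧ ∃ α β e : ℝ, 0 < α ∧ 0 < β ∧ 0 < e ∧ ∀ x : ℝ, (x : UnitAddCircle) = c →
      ∀ t, t ≠ x → |t - x| < r → schwarzian f.lift t < 0 ∧ α * |t - x| ^ e < deriv f.lift t ∧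
        deriv f.lift t < β * |t - x| ^ e := by
  obtain ⟨W, hW, -⟩ := f.nonflat
  obtain ⟨hWc, hS, α, β, s, hα, hαβ, hs, hp⟩ := hW c hc
  obtain ⟨r, hr, hball⟩ := Metric.mem_nhds_iff.1 hWc
  -- A radius of at most 1/2 makes the norm on the circle equal to the distance on the line.
  refine ⟨min r (1 / 2), lt_min hr (by norm_num), min_le_right _ _, α, β, s - 1, hα,
    hα.trans hαβ, by linarith, ?_⟩
  rintro x rfl t htx ht
  have hnorm : ‖(t : UnitAddCircle) - x‖ = |t - x| := by
    have : (t : UnitAddCircle) - x = ((t - x : ℝ) : UnitAddCircle) := by simp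
    rw [this]
    refine (AddCircle.norm_coe_eq_abs_iff (1 : ℝ) one_ne_zero).2 ?_
    have := ht.le.trans (min_le_right _ _)
    simpa using this
  have hmem : (t : UnitAddCircle) ∈ W x := by
    apply hball
    rw [Metric.mem_ball, dist_eq_norm, hnorm]
    exact ht.trans_le (min_le_left _ _)
  have hne : (t : UnitAddCircle) ≠ x := by
    intro h
    rw [h, sub_self, norm_zero] at hnorm
    exact htx (by linarith [abs_eq_zero.1 hnorm.symm])
  have := hp t hmem hne
  rw [hnorm] at this
  exact ⟨hS t hmem hne, this⟩

lemma exists_deriv_lift_le : ∃ D > 0, ∀ t, deriv f.lift t ≤ D := by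
  obtain ⟨x, -, hx⟩ := isCompact_Icc.exists_isMaxOn (s := Set.Icc (0 : ℝ) 1) ⟨0, by simp⟩
    f.continuous_deriv_lift.continuousOn
  refine ⟨deriv f.lift x + 1, by linarith [f.deriv_lift_nonneg x], fun t => ?_⟩
  have h1 : deriv f.lift (Int.fract t) ≤ deriv f.lift x :=
    hx (⟨Int.fract_nonneg t, (Int.fract_lt_one t).le⟩ : Int.fract t ∈ Set.Icc (0 : ℝ) 1)
  have h2 := f.deriv_lift_add_int (Int.fract t) ⌊t⌋
  rw [Int.fract_add_floor] at h2
  linarith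

/-- On long intervals the average slope is bounded below. -/
lemma exists_average_slope_ge {δ : ℝ} (hδ : 0 < δ) :
    ∃ η > 0, ∀ a d, a + δ ≤ d → η * (d - a) ≤ f.lift d - f.lift a := by
  obtain ⟨x, -, hx⟩ := isCompact_Icc.exists_isMinOn (s := Set.Icc (0 : ℝ) 1) ⟨0, by simp⟩
    (f := fun a => f.lift (a + δ) - f.lift a)
    ((f.continuous_lift.comp (continuous_id.add continuous_const)).sub
      f.continuous_lift).continuousOn
  set η := f.lift (x + δ) - f.lift x with hη
  have hη0 : 0 < η := sub_pos.2 (f.strictMono_lift (by linarith))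
  have hmin : ∀ a, η ≤ f.lift (a + δ) - f.lift a := by
    intro a
    have h1 : η ≤ f.lift (Int.fract a + δ) - f.lift (Int.fract a) :=
      hx (⟨Int.fract_nonneg a, (Int.fract_lt_one a).le⟩ : Int.fract a ∈ Set.Icc (0 : ℝ) 1)
    have h2 := f.lift.map_add_int (Int.fract a) ⌊a⌋
    have h3 := f.lift.map_add_int (Int.fract a + δ) ⌊a⌋
    rw [Int.fract_add_floor] at h2
    rw [add_right_comm, Int.fract_add_floor] at h3
    linarith
  -- Up to length 1 the increment is at least that of a subinterval of length δ. Beyond length 1,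
  -- the integer part of d - a is at least half of d - a, and the lift commutes with integer
  -- translations.
  refine ⟨min η (1 / 2), lt_min hη0 (by norm_num), fun a d had => ?_⟩
  rcases le_or_gt (d - a) 1 with h | h
  · have h1 := f.lift.monotone had
    have h2 := hmin a
    have h3 : min η (1 / 2) * (d - a) ≤ η * 1 :=
      mul_le_mul (min_le_left _ _) h (by linarith) hη0.le
    linarith
  · have h1 := f.lift.map_add_int a ⌊d - a⌋
    have h2 := f.lift.monotone (show a + ⌊d - a⌋ ≤ d by linarith [Int.floor_le (d - a)])
    have h3 : (1 : ℝ) ≤ ⌊d - a⌋ := by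
      exact_mod_cast Int.le_floor.2 (by push_cast; exact h.le)
    have h4 := Int.lt_floor_add_one (d - a)
    have h5 : min η (1 / 2) * (d - a) ≤ 1 / 2 * (d - a) :=
      mul_le_mul_of_nonneg_right (min_le_right _ _) (by linarith)
    linarith

/-- The derivative of the lift satisfies a reverse Hölder inequality: its maximum on an interval is
comparable with its average. -/
lemma exists_deriv_le_average : ∃ C ≥ 1, ∀ a d, a < d → ∀ t ∈ Set.Icc a d,
    deriv f.lift t * (d - a) ≤ C * (f.lift d - f.lift a) := by
  have key : ∃ δ > 0, ∃ C, ∀ a d, a < d → d < a + δ → a < d → ∀ t ∈ Set.Icc a d,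
      deriv f.lift t * (d - a) ≤ C * (f.lift d - f.lift a) := by
    refine exists_uniform_scale (Q := fun C a d => a < d → ∀ t ∈ Set.Icc a d,
        deriv f.lift t * (d - a) ≤ C * (f.lift d - f.lift a)) ?_ ?_ ?_
    · intro C C' a d hCC h had t ht
      exact (h had t ht).trans (mul_le_mul_of_nonneg_right hCC
        (sub_nonneg.2 (f.lift.monotone had.le)))
    · intro C a d k h had t ht
      have := h (by linarith) (t - k) ⟨by linarith [ht.1], by linarith [ht.2]⟩
      have e := f.deriv_lift_add_int (t - k) k
      rw [sub_add_cancel] at e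
      rw [f.lift.map_add_int, f.lift.map_add_int, e]
      calc _ = deriv f.lift (t - k) * (d - a) := by ring
        _ ≤ _ := this
        _ = _ := by ring
    · intro x
      by_cases hx : deriv f.lift x = 0
      · obtain ⟨r, hr, -, α, β, e, hα, hβ, he, hf⟩ :=
          f.exists_nonflat_lift (f.isCircleCritical_coe.2 hx)
        have hf := hf x rfl
        refine ⟨r, hr, 4 * (β / α) * 2 ^ e, fun a d ha had' hd had t ht => ?_⟩
        -- `m` is the distance from x to the farther endpoint, whether or not x lies in [a, d].
        obtain ⟨m, hm⟩ : ∃ m, m = max (x - a) (d - x) := ⟨_, rfl⟩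
        have hm1 : x - a ≤ m := hm ▸ le_max_left _ _
        have hm2 : d - x ≤ m := hm ▸ le_max_right _ _
        have hm0 : 0 < m := by linarith
        have hup : deriv f.lift t ≤ β * m ^ e := by
          by_cases htx : t = x
          · rw [htx, hx]; positivity
          · refine (hf t htx ?_).2.2.le.trans ?_
            · rw [abs_lt]; constructor <;> linarith [ht.1, ht.2]
            · have : |t - x| ≤ m := abs_le.2 ⟨by linarith [ht.1], by linarith [ht.2]⟩
              gcongr
        -- At the end of [a, d] farthest from x, a subinterval at least a quarter as long stays at
        -- distance at least m/2 from x. Its contribution alone bounds the average from below.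
        have hlow : ∀ u v, a ≤ u → u < v → v ≤ d → (∀ s ∈ Set.Icc u v, m / 2 ≤ |s - x|) →
            (d - a) / 4 ≤ v - u → α * (m / 2) ^ e * ((d - a) / 4) ≤ f.lift d - f.lift a := by
          intro u v hu huv hv hs hl
          obtain ⟨s, hs', hse⟩ := exists_deriv_eq_slope f.lift huv
            f.continuous_lift.continuousOn f.differentiable_lift.differentiableOn
          have hsI : s ∈ Set.Icc u v := Set.Ioo_subset_Icc_self hs'
          have h1 : f.lift v - f.lift u = deriv f.lift s * (v - u) := by
            have : v - u ≠ 0 := (sub_pos.2 huv).ne'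
            rw [hse]; field_simp
          have h2 : α * (m / 2) ^ e ≤ deriv f.lift s := by
            have hsx := hs s hsI
            have : s ≠ x := by rintro rfl; simp at hsx; linarith
            refine le_trans ?_ (hf s this ?_).2.1.le
            · gcongr
            · rw [abs_lt]; constructor <;> linarith [hsI.1, hsI.2]
          have h3 := f.lift.monotone hu
          have h4 := f.lift.monotone hv
          have h5 : α * (m / 2) ^ e * ((d - a) / 4) ≤ deriv f.lift s * (v - u) := by
            refine mul_le_mul h2 hl (by linarith) (f.deriv_lift_nonneg s)
          linarith
        have hlow' : α * (m / 2) ^ e * ((d - a) / 4) ≤ f.lift d - f.lift a := by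
          rcases le_total (x - a) (d - x) with h | h
          · have hmd : m = d - x := by rw [hm, max_eq_right h]
            refine hlow (max a (x + m / 2)) d (le_max_left _ _) (max_lt had (by linarith)) le_rfl
              (fun s hs => ?_) ?_
            · exact le_trans (by linarith [(le_max_right a _).trans hs.1]) (le_abs_self _)
            · rcases max_cases a (x + m / 2) with h' | h' <;> rw [h'.1] <;> linarith
          · have hmd : m = x - a := by rw [hm, max_eq_left h]
            refine hlow a (min d (x - m / 2)) le_rfl (lt_min had (by linarith)) (min_le_left _ _)
              (fun s hs => ?_) ?_
            · exact le_trans (by linarith [hs.2.trans (min_le_right d _)]) (neg_le_abs _)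
            · rcases min_cases d (x - m / 2) with h' | h' <;> rw [h'.1] <;> linarith
        have hpow : m ^ e = 2 ^ e * (m / 2) ^ e := by
          rw [← Real.mul_rpow (by norm_num) (by positivity)]; congr 1; ring
        calc deriv f.lift t * (d - a) ≤ β * m ^ e * (d - a) :=
              mul_le_mul_of_nonneg_right hup (by linarith)
          _ = 4 * (β / α) * 2 ^ e * (α * (m / 2) ^ e * ((d - a) / 4)) := by
              rw [hpow]; field_simp
          _ ≤ _ := mul_le_mul_of_nonneg_left hlow' (by positivity)
      · have hpos : 0 < deriv f.lift x := lt_of_le_of_ne (f.deriv_lift_nonneg x) (Ne.symm hx)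
        have hev : ∀ᶠ t in 𝓝 x, deriv f.lift t ∈ Set.Ioo (deriv f.lift x / 2) (2 * deriv f.lift x) :=
          f.continuous_deriv_lift.continuousAt (Ioo_mem_nhds (by linarith) (by linarith))
        obtain ⟨r, hr, hball⟩ := Metric.eventually_nhds_iff.1 hev
        refine ⟨r, hr, 4, fun a d ha had' hd had t ht => ?_⟩
        have hmem : ∀ s ∈ Set.Icc a d,
            deriv f.lift s ∈ Set.Ioo (deriv f.lift x / 2) (2 * deriv f.lift x) := by
          intro s hs
          apply hball
          rw [Real.dist_eq, abs_lt]
          constructor <;> linarith [hs.1, hs.2]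
        obtain ⟨s, hs', hse⟩ := exists_deriv_eq_slope f.lift had
          f.continuous_lift.continuousOn f.differentiable_lift.differentiableOn
        have hp : 0 < d - a := by linarith
        have h1 : f.lift d - f.lift a = deriv f.lift s * (d - a) := by
          rw [hse]; field_simp
        have h2 := (hmem s (Set.Ioo_subset_Icc_self hs')).1
        have h3 := (hmem t ht).2
        rw [h1]
        nlinarith
  obtain ⟨δ, hδ, C, hC⟩ := key
  obtain ⟨η, hη, h⟩ := f.exists_average_slope_ge hδ
  obtain ⟨D, hD, hDt⟩ := f.exists_deriv_lift_le
  refine ⟨max (max C (D / η)) 1, le_max_right _ _, fun a d had t ht => ?_⟩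
  have hpos : 0 < f.lift d - f.lift a := sub_pos.2 (f.strictMono_lift had)
  rcases lt_or_ge d (a + δ) with hd | hd
  · refine (hC a d had hd had t ht).trans (mul_le_mul_of_nonneg_right ?_ hpos.le)
    exact (le_max_left _ _).trans (le_max_left _ _)
  · calc deriv f.lift t * (d - a) ≤ D * (d - a) :=
          mul_le_mul_of_nonneg_right (hDt t) (by linarith)
      _ = D / η * (η * (d - a)) := by field_simp
      _ ≤ D / η * (f.lift d - f.lift a) :=
          mul_le_mul_of_nonneg_left (h a d hd) (by positivity)
      _ ≤ _ := mul_le_mul_of_nonneg_right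
          ((le_max_right _ _).trans (le_max_left _ _)) hpos.le

/-- Single-step bound for the distortion of cross-ratios. -/
lemma exists_crossRatio_lift_le : ∃ C ≥ 1, ∀ a b c d, a < b → b < c → c < d →
    crossRatio (f.lift a) (f.lift b) (f.lift c) (f.lift d) ≤ C * crossRatio a b c d := by
  obtain ⟨C, hC, h⟩ := f.exists_deriv_le_average
  refine ⟨C ^ 2, one_le_pow₀ hC, fun a b c d hab hbc hcd => ?_⟩
  exact crossRatio_le_of_slope f.strictMono_lift (by linarith) hab hbc hcd
    (slope_le_of_deriv_le f.differentiable_lift le_rfl hab hbc.le (h a c (hab.trans hbc)))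
    (slope_le_of_deriv_le f.differentiable_lift hbc.le hcd le_rfl (h b d (hbc.trans hcd)))

/-- Distortion of cross-ratios on short intervals without critical points. -/
lemma exists_crossRatio_lift_le_exp : ∃ δ > 0, ∃ K, ∀ a b c d, a < b → b < c → c < d →
    d < a + δ → (∀ t ∈ Set.Icc a d, deriv f.lift t ≠ 0) →
    crossRatio (f.lift a) (f.lift b) (f.lift c) (f.lift d) ≤
      Real.exp (K * (d - a)) * crossRatio a b c d := by
  have key : ∃ δ > 0, ∃ K, ∀ a d, a < d → d < a + δ → ∀ b c, a < b → b < c → c < d → (∀ t ∈ Set.Icc a d, deriv f.lift t ≠ 0) →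
        crossRatio (f.lift a) (f.lift b) (f.lift c) (f.lift d) ≤
          Real.exp (K * (d - a)) * crossRatio a b c d := by
    refine exists_uniform_scale (Q := fun K a d => ∀ b c, a < b → b < c → c < d → (∀ t ∈ Set.Icc a d, deriv f.lift t ≠ 0) →
        crossRatio (f.lift a) (f.lift b) (f.lift c) (f.lift d) ≤
          Real.exp (K * (d - a)) * crossRatio a b c d) ?_ ?_ ?_
    · intro C C' a d hCC h b c hab hbc hcd hcrit
      refine (h b c hab hbc hcd hcrit).trans
        (mul_le_mul_of_nonneg_right ?_ (crossRatio_nonneg hab hbc hcd))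
      exact Real.exp_le_exp.2 (mul_le_mul_of_nonneg_right hCC (by linarith))
    · intro C a d k h b c hab hbc hcd hcrit
      have := h (b - k) (c - k) (by linarith) (by linarith) (by linarith) (fun t ht => by
        rw [← f.deriv_lift_add_int t k]
        exact hcrit _ ⟨by linarith [ht.1], by linarith [ht.2]⟩)
      have eb := f.lift.map_add_int (b - k) k
      have ec := f.lift.map_add_int (c - k) k
      rw [sub_add_cancel] at eb ec
      rw [f.lift.map_add_int, f.lift.map_add_int, eb, ec]
      simp only [crossRatio] at this ⊢
      convert this using 2 <;> ring_nf
    · intro x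
      by_cases hx : deriv f.lift x = 0
      · obtain ⟨r, hr, -, α, β, e, hα, hβ, he, hf⟩ :=
          f.exists_nonflat_lift (f.isCircleCritical_coe.2 hx)
        have hf := hf x rfl
        -- In the neighbourhood of a critical point the Schwarzian derivative is negative, so an
        -- interval that avoids the point costs nothing.
        refine ⟨r, hr, 0, fun a d ha had hd b c hab hbc hcd hcrit => ?_⟩
        rw [zero_mul, Real.exp_zero, one_mul]
        refine crossRatio_le_of_schwarzian_nonpos f.strictMono_lift f.contDiff_lift hab hbc hcd
          (fun t ht => lt_of_le_of_ne (f.deriv_lift_nonneg t) (hcrit t ht).symm) (fun t ht => ?_)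
        refine (hf t ?_ ?_).1.le
        · rintro rfl; exact hcrit t ht hx
        · rw [abs_lt]; constructor <;> linarith [ht.1, ht.2]
      · have hcd : ContDiff ℝ 2 (deriv f.lift) :=
          ((contDiff_succ_iff_deriv (n := 2)).1 f.contDiff_lift).2.2
        obtain ⟨K, U, hU, hLip⟩ := ((hcd.contDiffAt.log hx).of_le
          (by norm_num : (1 : WithTop ℕ∞) ≤ 2)).exists_lipschitzOnWith
        obtain ⟨r, hr, hball⟩ := Metric.mem_nhds_iff.1 hU
        -- `K` is a Lipschitz constant of log F'; the factor 2 comes from the square in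
        -- `crossRatio_le_of_deriv_le`.
        refine ⟨r, hr, 2 * K, fun a d ha had hd b c hab hbc hcd hcrit => ?_⟩
        have hmem : ∀ s ∈ Set.Icc a d, s ∈ U := by
          intro s hs
          apply hball
          rw [Metric.mem_ball, Real.dist_eq, abs_lt]
          constructor <;> linarith [hs.1, hs.2]
        have hpos : ∀ t ∈ Set.Icc a d, 0 < deriv f.lift t := fun t ht =>
          lt_of_le_of_ne (f.deriv_lift_nonneg t) (hcrit t ht).symm
        have := crossRatio_le_of_deriv_le f.strictMono_lift f.differentiable_lift
          (C := Real.exp (K * (d - a))) (Real.exp_pos _).le hab hbc hcd (fun s hs t ht => ?_)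
        · refine this.trans (le_of_eq ?_)
          rw [← Real.exp_nat_mul]; congr 2; push_cast; ring
        · have h1 := hLip.dist_le_mul s (hmem s hs) t (hmem t ht)
          rw [Real.dist_eq, Real.dist_eq] at h1
          have h2 : |s - t| ≤ d - a :=
            abs_le.2 ⟨by linarith [hs.1, ht.2], by linarith [hs.2, ht.1]⟩
          have h3 := (le_abs_self _).trans (h1.trans (mul_le_mul_of_nonneg_left h2 K.2))
          rw [← Real.exp_log (hpos s hs), ← Real.exp_log (hpos t ht), ← Real.exp_add,
            Real.exp_le_exp]
          exact sub_le_iff_le_add.1 h3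
  obtain ⟨δ, hδ, K, h⟩ := key
  exact ⟨δ, hδ, K, fun a b c d hab hbc hcd hd =>
    h a d (hab.trans (hbc.trans hcd)) hd b c hab hbc hcd⟩

/-- Contraction of small scales at the critical points. -/
lemma exists_critical_contraction {η : ℝ} (hη : 0 < η) : ∃ ε > 0, ∀ c, deriv f.lift c = 0 →
    ∀ u v, 0 < u → 0 < v → v ≤ 1 → u ≤ ε * v →
      (f.lift (c + u) - f.lift c) * v ≤ η * (u * (f.lift (c + v) - f.lift c)) := by
  obtain ⟨C, hC, hrev⟩ := f.exists_deriv_le_average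
  have key : ∀ p ∈ {p : UnitAddCircle | IsCircleCritical f.lift p}, ∀ᶠ ε : ℝ in 𝓝[>] 0,
      ∀ c : ℝ, (c : UnitAddCircle) = p → ∀ u v, 0 < u → 0 < v → v ≤ 1 → u ≤ ε * v →
      (f.lift (c + u) - f.lift c) * v ≤ η * (u * (f.lift (c + v) - f.lift c)) := by
    intro p hp
    obtain ⟨r, hr, hr2, α, β, e, hα, hβ, he, hf⟩ := f.exists_nonflat_lift hp
    -- Chosen so that C β κ^e = η α.
    set κ : ℝ := (η * α / (C * β)) ^ (1 / e) with hκ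
    have hκ0 : 0 < κ := by positivity
    have hκe : κ ^ e = η * α / (C * β) := by
      rw [hκ, ← Real.rpow_mul (by positivity), one_div_mul_cancel he.ne', Real.rpow_one]
    filter_upwards [Ioo_mem_nhdsGT (show 0 < min (κ * (r / 2)) (r / 2) by positivity)]
      with ε hε c hc u v hu hv hv1 huv
    have hε1 : ε ≤ κ * (r / 2) := hε.2.le.trans (min_le_left _ _)
    have hε2 : ε ≤ r / 2 := hε.2.le.trans (min_le_right _ _)
    have hur : u < r := by nlinarith
    -- The point c + v may leave the neighbourhood where the power law holds, but c + w does not;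
    -- the reverse Hölder inequality carries the lower bound from c + w to the average over [c, c +
    -- v].
    obtain ⟨w, hw⟩ : ∃ w, w = v * (r / 2) := ⟨_, rfl⟩
    have hw0 : 0 < w := by rw [hw]; positivity
    have hwv : w ≤ v := by nlinarith
    have hwr : w < r := by nlinarith
    have huw : u ≤ κ * w := by
      rw [hw]; calc u ≤ ε * v := huv
        _ ≤ κ * (r / 2) * v := by gcongr
        _ = _ := by ring
    have hpu : u ^ e ≤ κ ^ e * w ^ e := by
      rw [← Real.mul_rpow hκ0.le hw0.le]; gcongr
    obtain ⟨s, hs, hse⟩ := exists_deriv_eq_slope f.lift (show c < c + u by linarith)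
      f.continuous_lift.continuousOn f.differentiable_lift.differentiableOn
    have h1 : f.lift (c + u) - f.lift c = deriv f.lift s * u := by
      rw [hse, add_sub_cancel_left]; field_simp
    have hs0 : |s - c| = s - c := abs_of_pos (by linarith [hs.1])
    have h2 : deriv f.lift s ≤ β * u ^ e := by
      have := (hf c hc s hs.1.ne' (by rw [hs0]; linarith [hs.2])).2.2.le
      rw [hs0] at this
      refine this.trans ?_
      have h3 : s - c ≤ u := by linarith [hs.2]
      have h4 : 0 ≤ s - c := by linarith [hs.1]
      gcongr
    have h3 : α * w ^ e ≤ deriv f.lift (c + w) := by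
      have := (hf c hc (c + w) (by linarith) (by rwa [add_sub_cancel_left, abs_of_pos hw0])).2.1.le
      rwa [add_sub_cancel_left, abs_of_pos hw0] at this
    have h4 := hrev c (c + v) (by linarith) (c + w) ⟨by linarith, by linarith⟩
    rw [add_sub_cancel_left] at h4
    have h5 : α * w ^ e * v ≤ C * (f.lift (c + v) - f.lift c) :=
      (mul_le_mul_of_nonneg_right h3 hv.le).trans h4
    have hC0 : 0 < C := by linarith
    calc (f.lift (c + u) - f.lift c) * v ≤ β * (κ ^ e * w ^ e) * u * v := by
          rw [h1]; gcongr; exact h2.trans (by gcongr)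
      _ = η / C * u * (α * w ^ e * v) := by rw [hκe]; field_simp
      _ ≤ η / C * u * (C * (f.lift (c + v) - f.lift c)) := by gcongr
      _ = _ := by field_simp
  have := ((Filter.eventually_all_finite f.finite_critical).2 key).and self_mem_nhdsWithin
  obtain ⟨ε, hε, hε0⟩ := this.exists
  exact ⟨ε, hε0, fun c hc => hε c (f.isCircleCritical_coe.2 hc) c rfl⟩

/-- Lebesgue measure plus a unit mass at each critical point. -/
def criticalMeasure : Measure UnitAddCircle :=
  volume + ∑ c ∈ f.finite_critical.toFinset, Measure.dirac c

instance : IsFiniteMeasure f.criticalMeasure := by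
  unfold criticalMeasure; infer_instance

lemma arcLength_le_criticalMeasure (A : Set UnitAddCircle) :
    arcLength A ≤ f.criticalMeasure.real A := by
  refine ENNReal.toReal_mono (measure_ne_top _ _) ?_
  rw [criticalMeasure, Measure.add_apply]
  exact le_self_add

lemma one_le_criticalMeasure {A : Set UnitAddCircle} {c : UnitAddCircle}
    (hc : IsCircleCritical f.lift c) (hcA : c ∈ A) : 1 ≤ f.criticalMeasure.real A := by
  refine (ENNReal.ofReal_le_iff_le_toReal (measure_ne_top _ _)).1 ?_
  rw [criticalMeasure, Measure.add_apply, ENNReal.ofReal_one, Measure.finsetSum_apply]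
  refine le_add_left ?_
  calc (1 : ENNReal) = Measure.dirac c A := (Measure.dirac_apply_of_mem hcA).symm
    _ ≤ _ := Finset.single_le_sum (f := fun c => Measure.dirac c A) (fun _ _ => zero_le)
      (f.finite_critical.mem_toFinset.2 hc)

/-- A hull that contains a critical point has mass at least 1, and a long hull has mass at least δ'.
In both cases the bounded factor C is absorbed into exp(K μ). A short hull without critical points
already has the exponential bound. The exponents are additive along orbits. -/
lemma exists_crossRatio_lift_le_exp_measure : ∃ K ≥ 0, ∀ a b c d, a < b → b < c → c < d →
    crossRatio (f.lift a) (f.lift b) (f.lift c) (f.lift d) ≤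
      Real.exp (K * f.criticalMeasure.real ((fun t : ℝ => (t : UnitAddCircle)) '' Set.Icc a d))
        * crossRatio a b c d := by
  obtain ⟨C, hC, h⟩ := f.exists_crossRatio_lift_le
  obtain ⟨δ, hδ, K, hK⟩ := f.exists_crossRatio_lift_le_exp
  obtain ⟨δ', hδ'⟩ : ∃ δ', δ' = min δ 1 := ⟨_, rfl⟩
  have hδ0 : 0 < δ' := by rw [hδ']; positivity
  have hδ1 : δ' ≤ 1 := hδ' ▸ min_le_right _ _
  have hδδ : δ' ≤ δ := hδ' ▸ min_le_left _ _
  have hlog : 0 ≤ Real.log C := Real.log_nonneg hC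
  refine ⟨max |K| (Real.log C / δ'), le_max_of_le_left (abs_nonneg K),
    fun a b c d hab hbc hcd => ?_⟩
  have had : a < d := hab.trans (hbc.trans hcd)
  set μ := f.criticalMeasure.real ((fun t : ℝ => (t : UnitAddCircle)) '' Set.Icc a d)
  have hbad : δ' ≤ μ → crossRatio (f.lift a) (f.lift b) (f.lift c) (f.lift d) ≤
      Real.exp (max |K| (Real.log C / δ') * μ) * crossRatio a b c d := by
    intro hμ
    refine (h a b c d hab hbc hcd).trans
      (mul_le_mul_of_nonneg_right ?_ (crossRatio_nonneg hab hbc hcd))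
    rw [← Real.log_le_iff_le_exp (by linarith)]
    calc Real.log C = Real.log C / δ' * δ' := by field_simp
      _ ≤ _ := mul_le_mul (le_max_right _ _) hμ hδ0.le (le_max_of_le_left (abs_nonneg K))
  by_cases hcrit : ∃ t ∈ Set.Icc a d, deriv f.lift t = 0
  · obtain ⟨t, ht, ht0⟩ := hcrit
    exact hbad (hδ1.trans (f.one_le_criticalMeasure (f.isCircleCritical_coe.2 ht0) ⟨t, ht, rfl⟩))
  push Not at hcrit
  rcases lt_or_ge d (a + δ') with hd | hd
  · refine (hK a b c d hab hbc hcd (by linarith) hcrit).trans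
      (mul_le_mul_of_nonneg_right ?_ (crossRatio_nonneg hab hbc hcd))
    refine Real.exp_le_exp.2 (mul_le_mul ((le_abs_self K).trans (le_max_left _ _)) ?_
      (by linarith) (le_max_of_le_left (abs_nonneg K)))
    exact (le_arcLength_coe_image_Icc (by linarith)).trans (f.arcLength_le_criticalMeasure _)
  · refine hbad (le_trans ?_ ((arcLength_mono (Set.image_mono
      (Set.Icc_subset_Icc_right hd))).trans (f.arcLength_le_criticalMeasure _)))
    have := le_arcLength_coe_image_Icc (a := a) (b := a + δ') (by linarith)
    linarith

end MulticriticalCircleMap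

/-! ### The action of ℤ × ℤ on the line, ordered by displacement -/

namespace MulticriticalCircleMap

variable (f : MulticriticalCircleMap)

lemma bijective_lift : Function.Bijective f.lift :=
  ⟨f.strictMono_lift.injective, f.continuous_lift.surjective f.lift.tendsto_atTop
    f.lift.tendsto_atBot⟩

/-- The lift as an invertible element of the monoid of lifts. -/
def liftUnit : CircleDeg1Liftˣ := (CircleDeg1Lift.isUnit_iff_bijective.2 f.bijective_lift).unit

lemma coe_liftUnit : (f.liftUnit : CircleDeg1Lift) = f.lift := rfl

/-- The action of `ℤ × ℤ` on the line generated by the lift and the unit translation. -/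
def act (v : ℤ × ℤ) (x : ℝ) : ℝ := ((f.liftUnit ^ v.1 : CircleDeg1Liftˣ) : CircleDeg1Lift) x + v.2

lemma act_add (v w : ℤ × ℤ) (x : ℝ) : f.act (v + w) x = f.act v (f.act w x) := by
  simp only [act, Prod.fst_add, Prod.snd_add, zpow_add, Units.val_mul, CircleDeg1Lift.mul_apply,
    CircleDeg1Lift.map_add_int]
  push_cast; ring

@[simp] lemma act_zero (x : ℝ) : f.act 0 x = x := by simp [act]

lemma act_natCast (n : ℕ) (p : ℤ) (x : ℝ) : f.act (n, p) x = f.lift^[n] x + p := by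
  simp [act, coe_liftUnit, CircleDeg1Lift.coe_pow]

lemma act_int (p : ℤ) (x : ℝ) : f.act (0, p) x = x + p := by simp [act]

lemma strictMono_act (v : ℤ × ℤ) : StrictMono (f.act v) := fun _ _ h =>
  add_lt_add_left ((CircleDeg1Lift.toOrderIso (f.liftUnit ^ v.1)).strictMono h) _

lemma continuous_act (v : ℤ × ℤ) : Continuous (f.act v) :=
  (CircleDeg1Lift.toOrderIso (f.liftUnit ^ v.1)).continuous.add continuous_const

lemma act_add_int (v : ℤ × ℤ) (x : ℝ) (k : ℤ) : f.act v (x + k) = f.act v x + k := by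
  rw [← f.act_int, ← f.act_int, ← f.act_add, ← f.act_add, add_comm]

/-- The displacement of the rotation that corresponds to an element of `ℤ × ℤ`. -/
def theta (v : ℤ × ℤ) : ℝ := v.1 * f.lift.translationNumber + v.2

lemma theta_add (v w : ℤ × ℤ) : f.theta (v + w) = f.theta v + f.theta w := by
  simp [theta]; ring

lemma theta_sub (v w : ℤ × ℤ) : f.theta (v - w) = f.theta v - f.theta w := by
  simp [theta]; ring

lemma theta_neg (v : ℤ × ℤ) : f.theta (-v) = -f.theta v := by
  simp [theta]; ring

lemma theta_nsmul (k : ℕ) (v : ℤ × ℤ) : f.theta (k • v) = k * f.theta v := by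
  simp [theta]; ring

lemma theta_zsmul (k : ℤ) (v : ℤ × ℤ) : f.theta (k • v) = k * f.theta v := by
  simp [theta]; ring

lemma theta_int (p : ℤ) : f.theta (0, p) = p := by simp [theta]

/-- A lift whose translation number exceeds an integer moves every point by more than that integer.
Hence orbits on the line are ordered as for the rotation, and comparisons reduce to arithmetic with
`theta`. -/
lemma lt_act_of_theta_pos {v : ℤ × ℤ} (h : 0 < f.theta v) (x : ℝ) : x < f.act v x := by
  have h1 : ((-v.2 : ℤ) : ℝ) <
      ((f.liftUnit ^ v.1 : CircleDeg1Liftˣ) : CircleDeg1Lift).translationNumber := by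
    rw [CircleDeg1Lift.translationNumber_zpow, coe_liftUnit]
    rw [theta] at h
    push_cast; linarith
  have h2 := CircleDeg1Lift.lt_map_of_int_lt_translationNumber _ h1 x
  rw [act]
  push_cast at h2; linarith

lemma act_lt_act {v w : ℤ × ℤ} (h : f.theta v < f.theta w) (x : ℝ) : f.act v x < f.act w x := by
  have := f.lt_act_of_theta_pos (v := w - v) (by rw [theta_sub]; linarith) (f.act v x)
  rwa [← f.act_add, sub_add_cancel] at this

lemma iter_coe (m : ℕ) (x : ℝ) : f.iter m (x : UnitAddCircle) = (f.lift^[m] x : ℝ) := by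
  induction m generalizing x with
  | zero => rfl
  | succ m ih =>
    rw [iter, Function.iterate_succ_apply, ← f.coe_lift, Function.iterate_succ_apply]
    exact ih _

section Irrational

variable {f} (hf : Function.periodicPts f.toHomeomorph = ∅)

include hf

lemma irrational_translationNumber : Irrational f.lift.translationNumber := by
  rintro ⟨r, hr⟩
  obtain ⟨x, hx⟩ := (f.lift.translationNumber_eq_rat_iff f.continuous_lift
    (m := r.num) r.den_pos).1 (by rw [← hr]; exact_mod_cast r.num_div_den.symm)
  have h : (x : UnitAddCircle) ∈ Function.periodicPts f.toHomeomorph := by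
    refine ⟨r.den, r.den_pos, ?_⟩
    change f.iter r.den x = x
    rw [f.iter_coe, ← CircleDeg1Lift.coe_pow, hx]
    have : ((r.num : ℝ) : UnitAddCircle) = 0 :=
      (AddCircle.coe_eq_zero_iff (1 : ℝ)).2 ⟨r.num, by simp⟩
    rw [AddCircle.coe_add, this, add_zero]
  rw [hf] at h
  exact h

lemma theta_injective : Function.Injective f.theta := by
  intro v w h
  by_cases h1 : v.1 = w.1
  · refine Prod.ext h1 ?_
    simp only [theta, h1] at h
    exact_mod_cast add_left_cancel h
  · exfalso
    refine (irrational_translationNumber hf) ⟨(w.2 - v.2) / (v.1 - w.1), ?_⟩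
    have h2 : ((v.1 : ℝ) - w.1) ≠ 0 := sub_ne_zero.2 (by exact_mod_cast h1)
    push_cast
    rw [div_eq_iff h2]
    simp only [theta] at h
    linarith

lemma act_le_act {v w : ℤ × ℤ} (h : f.theta v ≤ f.theta w) (x : ℝ) : f.act v x ≤ f.act w x := by
  rcases h.eq_or_lt with h | h
  · rw [theta_injective hf h]
  · exact (f.act_lt_act h x).le

end Irrational

end MulticriticalCircleMap

/-! ### Continued fractions, return times and best approximation -/

/-- The orbit of a real number under the Gauss map. -/
def gaussOrbit (ρ : ℝ) : ℕ → ℝ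
  | 0 => ρ
  | n + 1 => Int.fract (gaussOrbit ρ n)⁻¹

lemma irrational_gaussOrbit {ρ : ℝ} (h : Irrational ρ) (n : ℕ) : Irrational (gaussOrbit ρ n) := by
  induction n with
  | zero => exact h
  | succ n ih => exact ih.inv.sub_intCast _

lemma gaussOrbit_mem {ρ : ℝ} (h : Irrational ρ) (h0 : ρ ∈ Set.Ioo (0 : ℝ) 1) (n : ℕ) :
    gaussOrbit ρ n ∈ Set.Ioo (0 : ℝ) 1 := by
  cases n with
  | zero => exact h0
  | succ n =>
    refine ⟨lt_of_le_of_ne (Int.fract_nonneg _) ?_, Int.fract_lt_one _⟩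
    exact (irrational_gaussOrbit h (n + 1)).ne_zero.symm

/-- Links Mathlib's continued fraction stream with the Gauss map. Since ρ lies in (0, 1), the zeroth
integer part is 0 and the orbit starts at ρ itself. -/
lemma exists_stream_eq {ρ : ℝ} (h : Irrational ρ) (h0 : ρ ∈ Set.Ioo (0 : ℝ) 1) (n : ℕ) :
    ∃ p, GenContFract.IntFractPair.stream ρ n = some p ∧ p.fr = gaussOrbit ρ n := by
  induction n with
  | zero => exact ⟨_, GenContFract.IntFractPair.stream_zero ρ,
      Int.fract_eq_self.2 ⟨h0.1.le, h0.2⟩⟩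
  | succ n ih =>
    obtain ⟨p, hp, hfr⟩ := ih
    refine ⟨_, GenContFract.IntFractPair.stream_succ_of_some hp ?_, ?_⟩
    · rw [hfr]; exact (irrational_gaussOrbit h n).ne_zero
    · rw [hfr]; rfl

lemma partDens_get?_eq {ρ : ℝ} (h : Irrational ρ) (h0 : ρ ∈ Set.Ioo (0 : ℝ) 1) (n : ℕ) :
    (GenContFract.of ρ).partDens.get? n = some ((⌊(gaussOrbit ρ n)⁻¹⌋ : ℤ) : ℝ) := by
  obtain ⟨p, hp, hfr⟩ := exists_stream_eq h h0 n
  have h1 := GenContFract.IntFractPair.stream_succ_of_some hp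
    (by rw [hfr]; exact (irrational_gaussOrbit h n).ne_zero)
  rw [GenContFract.partDen_eq_s_b
    (GenContFract.get?_of_eq_some_of_succ_get?_intFractPair_stream h1), hfr]
  rfl

namespace MulticriticalCircleMap

variable (f : MulticriticalCircleMap)

section Irrational

variable {f} (hf : Function.periodicPts f.toHomeomorph = ∅)

include hf

lemma irrational_rotationNumber : Irrational f.rotationNumber :=
  (irrational_translationNumber hf).sub_intCast _

lemma rotationNumber_mem : f.rotationNumber ∈ Set.Ioo (0 : ℝ) 1 :=
  ⟨lt_of_le_of_ne (Int.fract_nonneg _) (irrational_rotationNumber hf).ne_zero.symm,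
    Int.fract_lt_one _⟩

lemma gaussOrbit_rotationNumber_mem (n : ℕ) :
    gaussOrbit f.rotationNumber n ∈ Set.Ioo (0 : ℝ) 1 :=
  gaussOrbit_mem (irrational_rotationNumber hf) (rotationNumber_mem hf) n

lemma a_eq (n : ℕ) : (f.a n : ℝ) = ⌊(gaussOrbit f.rotationNumber n)⁻¹⌋ := by
  have h0 : 0 ≤ ⌊(gaussOrbit f.rotationNumber n)⁻¹⌋ :=
    Int.floor_nonneg.2 (inv_nonneg.2 (gaussOrbit_rotationNumber_mem hf n).1.le)
  rw [a, partDens_get?_eq (irrational_rotationNumber hf) (rotationNumber_mem hf),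
    Option.getD_some, natCast_floor_eq_intCast_floor (by exact_mod_cast h0), Int.floor_intCast]

lemma one_le_a (n : ℕ) : 1 ≤ f.a n := by
  have h := gaussOrbit_rotationNumber_mem hf n
  have h1 : (1 : ℤ) ≤ ⌊(gaussOrbit f.rotationNumber n)⁻¹⌋ :=
    Int.le_floor.2 (by push_cast; exact (one_lt_inv₀ h.1).2 h.2 |>.le)
  have h2 : (1 : ℝ) ≤ f.a n := by rw [a_eq hf]; exact_mod_cast h1
  exact_mod_cast h2

lemma one_le_q (n : ℕ) : 1 ≤ f.q n ∧ 1 ≤ f.q (n + 1) := by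
  induction n with
  | zero => exact ⟨le_rfl, one_le_a hf 0⟩
  | succ n ih => exact ⟨ih.2, le_add_left ih.1⟩

lemma q_le_q_succ (n : ℕ) : f.q n ≤ f.q (n + 1) := by
  cases n with
  | zero => exact one_le_a hf 0
  | succ n => exact le_add_right (Nat.le_mul_of_pos_left _ (one_le_a hf _))

end Irrational

/-- The element `(-1)ⁿ (qₙ, -pₙ)` of `ℤ × ℤ`; it moves points in the positive direction. -/
def sigma : ℕ → ℤ × ℤ
  | 0 => (1, -⌊f.lift.translationNumber⌋)
  | 1 => (-(f.a 0 : ℤ), f.a 0 * ⌊f.lift.translationNumber⌋ + 1)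
  | n + 2 => sigma n - (f.a (n + 1) : ℤ) • sigma (n + 1)

lemma sigma_fst (n : ℕ) : (f.sigma n).1 = (-1) ^ n * f.q n ∧
    (f.sigma (n + 1)).1 = (-1) ^ (n + 1) * f.q (n + 1) := by
  induction n with
  | zero => simp [sigma, q]
  | succ n ih =>
    refine ⟨ih.2, ?_⟩
    simp only [sigma, q, Prod.fst_sub, Prod.smul_fst, ih.1, ih.2, smul_eq_mul]
    push_cast; ring

/-- The determinant is ±1, so two consecutive `sigma`s form a basis of ℤ × ℤ. -/
lemma sigma_det (n : ℕ) : (f.sigma n).1 * (f.sigma (n + 1)).2 - (f.sigma n).2 * (f.sigma (n + 1)).1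
    = (-1) ^ n := by
  induction n with
  | zero => simp [sigma]; ring
  | succ n ih =>
    rw [pow_succ, ← ih]
    simp only [sigma, Prod.fst_sub, Prod.smul_fst, Prod.snd_sub, Prod.smul_snd, smul_eq_mul]
    ring

section Irrational

variable {f} (hf : Function.periodicPts f.toHomeomorph = ∅)

include hf

/-- The recursion for `sigma` is the Euclidean algorithm for the displacements: subtracting a_{n+1}
copies of the smaller from the larger leaves the fractional part of their quotient, which is the
next Gauss iterate. -/
lemma theta_sigma (n : ℕ) : 0 < f.theta (f.sigma n) ∧
    f.theta (f.sigma (n + 1)) = f.theta (f.sigma n) * gaussOrbit f.rotationNumber (n + 1) := by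
  induction n with
  | zero =>
    have h := rotationNumber_mem hf
    have h0 : f.theta (f.sigma 0) = f.rotationNumber := by
      simp only [theta, sigma, rotationNumber, Int.fract]; push_cast; ring
    refine ⟨h0 ▸ h.1, ?_⟩
    have h2 : f.theta (f.sigma 1) = 1 - f.a 0 * f.rotationNumber := by
      simp only [theta, sigma, rotationNumber, Int.fract]; push_cast; ring
    rw [h0, h2, gaussOrbit, Int.fract, ← a_eq hf 0, gaussOrbit, mul_sub,
      mul_inv_cancel₀ h.1.ne', mul_comm]
  | succ n ih =>
    have h := gaussOrbit_rotationNumber_mem hf (n + 1)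
    refine ⟨ih.2 ▸ mul_pos ih.1 h.1, ?_⟩
    have h2 : f.theta (f.sigma (n + 2)) =
        f.theta (f.sigma n) - f.a (n + 1) * f.theta (f.sigma (n + 1)) := by
      rw [sigma, theta_sub, theta_zsmul]; push_cast; ring
    rw [h2, gaussOrbit, Int.fract, ← a_eq hf (n + 1), ih.2, mul_sub]
    field_simp [h.1.ne']

lemma theta_sigma_pos (n : ℕ) : 0 < f.theta (f.sigma n) := (theta_sigma hf n).1

lemma theta_sigma_succ_lt (n : ℕ) : f.theta (f.sigma (n + 1)) < f.theta (f.sigma n) := by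
  rw [(theta_sigma hf n).2]
  exact mul_lt_of_lt_one_right (theta_sigma_pos hf n) (gaussOrbit_rotationNumber_mem hf _).2

lemma theta_sigma_lt_one (n : ℕ) : f.theta (f.sigma n) < 1 := by
  induction n with
  | zero =>
    have h0 : f.theta (f.sigma 0) = f.rotationNumber := by
      simp only [theta, sigma, rotationNumber, Int.fract]; push_cast; ring
    exact h0 ▸ (rotationNumber_mem hf).2
  | succ n ih => exact (theta_sigma_succ_lt hf n).trans ih

/-- Best approximation property of the return times. -/
lemma theta_sigma_le_abs_theta {n : ℕ} {v : ℤ × ℤ} (h0 : v.1 ≠ 0) (hlt : |v.1| < f.q (n + 1)) :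
    f.theta (f.sigma n) ≤ |f.theta v| := by
  obtain ⟨h1, h2⟩ := f.sigma_fst n
  have hdet := f.sigma_det n
  have hθ := theta_sigma_pos hf n
  have hθ' := theta_sigma_pos hf (n + 1)
  set s := f.sigma n
  set t := f.sigma (n + 1)
  obtain ⟨D, hD⟩ : ∃ D : ℤ, D = (-1) ^ n := ⟨_, rfl⟩
  have hDD : D * D = 1 := by rw [hD, ← pow_add, ← two_mul]; simp
  have hD' : D = 1 ∨ D = -1 := hD ▸ neg_one_pow_eq_or ℤ n
  rw [← hD] at hdet
  -- Coordinates of `v` in the basis σₙ, σₙ₊₁ by Cramer's rule; D = ±1 is its own inverse.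
  obtain ⟨A, hA⟩ : ∃ A, A = D * (v.1 * t.2 - v.2 * t.1) := ⟨_, rfl⟩
  obtain ⟨B, hB⟩ : ∃ B, B = D * (s.1 * v.2 - s.2 * v.1) := ⟨_, rfl⟩
  have hv : v = A • s + B • t := by
    refine Prod.ext ?_ ?_
    · simp only [Prod.fst_add, Prod.smul_fst, smul_eq_mul, hA, hB]
      linear_combination (-v.1) * hDD - D * v.1 * hdet
    · simp only [Prod.snd_add, Prod.smul_snd, smul_eq_mul, hA, hB]
      linear_combination (-v.2) * hDD - D * v.2 * hdet
  have hv1 : v.1 = D * (A * f.q n - B * f.q (n + 1)) := by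
    have := congrArg Prod.fst hv
    simp only [Prod.fst_add, Prod.smul_fst, smul_eq_mul, h1, h2, pow_succ, ← hD] at this
    rw [this]; ring
  have hθv : f.theta v = A * f.theta s + B * f.theta t := by
    conv_lhs => rw [hv]
    rw [theta_add, theta_zsmul, theta_zsmul]
  have habs : |v.1| = |A * f.q n - B * f.q (n + 1)| := by
    rw [hv1, abs_mul]
    rcases hD' with h | h <;> simp [h]
  have hq : (1 : ℤ) ≤ f.q n := by exact_mod_cast (one_le_q hf n).1
  have hq' : (1 : ℤ) ≤ f.q (n + 1) := by exact_mod_cast (one_le_q hf n).2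
  rw [habs, abs_lt] at hlt
  -- The bound |A qₙ - B qₙ₊₁| < qₙ₊₁ rules out A = 0 and opposite signs of A and B. The two
  -- displacements are positive, so their contributions add up in absolute value.
  rcases lt_trichotomy A 0 with hA0 | hA0 | hA0
  · have hB0 : B ≤ 0 := by
      by_contra hB0
      push Not at hB0
      nlinarith
    have e1 : (A : ℝ) ≤ -1 := by exact_mod_cast (by omega : A ≤ -1)
    have e2 : (B : ℝ) ≤ 0 := by exact_mod_cast hB0
    rw [hθv]
    refine le_trans ?_ (neg_le_abs _)
    nlinarith
  · exfalso
    rw [hA0] at hlt hv1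
    have hB0 : B = 0 := by
      by_contra hB0
      rcases lt_or_gt_of_ne hB0 with h | h <;> nlinarith
    rw [hB0] at hv1
    simp at hv1
    exact h0 hv1
  · have hB0 : 0 ≤ B := by
      by_contra hB0
      push Not at hB0
      nlinarith
    have e1 : (1 : ℝ) ≤ A := by exact_mod_cast hA0
    have e2 : (0 : ℝ) ≤ B := by exact_mod_cast hB0
    rw [hθv]
    refine le_trans ?_ (le_abs_self _)
    nlinarith

/-- Every orbit visits every interval `[v, σₙ v)` within `qₙ + qₙ₊₁` iterates. -/
lemma exists_act_mem_Ico (n : ℕ) (x v : ℝ) : ∃ i : ℕ, i < f.q n + f.q (n + 1) ∧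
    ∃ p : ℤ, f.act (i, p) x ∈ Set.Ico v (f.act (f.sigma n) v) := by
  have hq := (one_le_q hf n).1
  -- The largest integer p for which the i-th iterate, translated by p, lies strictly left of v.
  let P : ℕ → ℤ := fun i => ⌈v - f.lift^[i] x⌉ - 1
  have hP : ∀ i : ℕ, f.act ((i : ℤ), P i) x < v := by
    intro i
    rw [act_natCast]
    have := Int.ceil_lt_add_one (v - f.lift^[i] x)
    simp only [P]; push_cast; linarith
  have hP' : ∀ (i : ℕ) (p : ℤ), f.act ((i : ℤ), p) x < v →
      f.act ((i : ℤ), p) x ≤ f.act ((i : ℤ), P i) x := by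
    intro i p h
    rw [act_natCast] at h ⊢
    rw [act_natCast]
    have : p < ⌈v - f.lift^[i] x⌉ := Int.lt_ceil.2 (by linarith)
    have h2 : p ≤ P i := by simp only [P]; omega
    have h3 : (p : ℝ) ≤ P i := by exact_mod_cast h2
    linarith
  obtain ⟨i, hi, hmax⟩ := Finset.exists_max_image (Finset.range (f.q n + f.q (n + 1)))
    (fun i : ℕ => f.act ((i : ℤ), P i) x) ⟨0, by simp; omega⟩
  rw [Finset.mem_range] at hi
  obtain ⟨h1, h2⟩ := f.sigma_fst n
  -- One of σₙ, σₙ₊₁ raises the number of iterates and the other lowers it. Below qₙ + qₙ₊₁ at least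
  -- one of these moves stays in range.
  have hexists : ∃ t, (t = f.sigma n ∨ t = f.sigma (n + 1)) ∧
      ∃ j : ℕ, j < f.q n + f.q (n + 1) ∧ t.1 + i = j := by
    rcases neg_one_pow_eq_or ℤ n with h | h
    · rw [h] at h1
      rw [pow_succ, h] at h2
      by_cases hi' : i < f.q (n + 1)
      · exact ⟨_, Or.inl rfl, i + f.q n, by omega, by rw [h1]; push_cast; ring⟩
      · refine ⟨_, Or.inr rfl, i - f.q (n + 1), by omega, ?_⟩
        rw [h2]; push_cast [Nat.cast_sub (not_lt.1 hi')]; ring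
    · rw [h] at h1
      rw [pow_succ, h] at h2
      by_cases hi' : i < f.q n
      · exact ⟨_, Or.inr rfl, i + f.q (n + 1), by omega, by rw [h2]; push_cast; ring⟩
      · refine ⟨_, Or.inl rfl, i - f.q n, by omega, ?_⟩
        rw [h1]; push_cast [Nat.cast_sub (not_lt.1 hi')]; ring
  obtain ⟨t, ht, j, hj, htj⟩ := hexists
  have htpos : 0 < f.theta t := by
    rcases ht with rfl | rfl
    · exact theta_sigma_pos hf n
    · exact theta_sigma_pos hf (n + 1)
  have htle : f.theta t ≤ f.theta (f.sigma n) := by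
    rcases ht with rfl | rfl
    · exact le_rfl
    · exact (theta_sigma_succ_lt hf n).le
  have he : f.act ((j : ℤ), t.2 + P i) x = f.act t (f.act ((i : ℤ), P i) x) := by
    rw [← f.act_add]; congr 1; exact Prod.ext htj.symm rfl
  refine ⟨j, hj, t.2 + P i, ?_, ?_⟩
  -- The chosen point is the closest one to the left of v, so a move to the right cannot end left of
  -- v again.
  · by_contra hlt
    push Not at hlt
    have h3 := hP' j _ hlt
    have h4 := hmax j (Finset.mem_range.2 hj)
    have h5 := f.lt_act_of_theta_pos htpos (f.act ((i : ℤ), P i) x)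
    rw [he] at h3
    linarith
  · rw [he]
    exact (f.strictMono_act t (hP i)).trans_le (act_le_act hf htle v)

end Irrational

end MulticriticalCircleMap

/-! ### The cross-ratio inequality for iterates -/

lemma measurableSet_coe_image_Ico (a b : ℝ) :
    MeasurableSet ((fun t : ℝ => (t : UnitAddCircle)) '' Set.Ico a b) := by
  rcases le_or_gt b a with h | h
  · rw [Set.Ico_eq_empty_of_le h, Set.image_empty]; exact MeasurableSet.empty
  · rw [← Set.Ioo_insert_left h, Set.image_insert_eq]
    exact ((QuotientAddGroup.isOpenMap_coe _ isOpen_Ioo).measurableSet).insert _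

namespace MulticriticalCircleMap

variable (f : MulticriticalCircleMap)

lemma act_natCast_zero (n : ℕ) (x : ℝ) : f.act ((n : ℤ), 0) x = f.lift^[n] x := by
  rw [act_natCast]; simp

lemma strictMono_iterate (n : ℕ) : StrictMono f.lift^[n] := f.strictMono_lift.iterate n

section Irrational

variable {f} (hf : Function.periodicPts f.toHomeomorph = ∅)

include hf

/-- The first `qₙ₊₁` images of a fundamental interval `[y, σₙ y)` are disjoint on the circle. -/
lemma sum_measure_iterate_Ico_le (n : ℕ) (y : ℝ) :
    ∑ i ∈ Finset.range (f.q (n + 1)), f.criticalMeasure.real ((fun t : ℝ => (t : UnitAddCircle)) ''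
      Set.Ico (f.lift^[i] y) (f.lift^[i] (f.act (f.sigma n) y))) ≤
      f.criticalMeasure.real Set.univ := by
  rw [← measureReal_biUnion_finset]
  · exact measureReal_mono (Set.subset_univ _)
  · intro i hi j hj hij
    rw [Function.onFun, Set.disjoint_left]
    rintro _ ⟨w, hw, rfl⟩ ⟨w', hw', hww⟩
    obtain ⟨k, hk⟩ := exists_int_of_coe_eq hww
    have hback : ∀ (i : ℕ) (w : ℝ), w ∈ Set.Ico (f.lift^[i] y) (f.lift^[i] (f.act (f.sigma n) y)) →
        f.act (-(i : ℤ), 0) w ∈ Set.Ico y (f.act (f.sigma n) y) := by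
      intro i w hw
      have e : ∀ z, f.act (-(i : ℤ), 0) (f.lift^[i] z) = z := by
        intro z
        rw [← f.act_natCast_zero, ← f.act_add]
        convert f.act_zero z
        ext <;> simp
      have h1 := (f.strictMono_act (-(i : ℤ), 0)).monotone hw.1
      have h2 := f.strictMono_act (-(i : ℤ), 0) hw.2
      rw [e] at h1 h2
      exact ⟨h1, h2⟩
    have hs := hback i w hw
    have hs' := hback j w' hw'
    set s := f.act (-(i : ℤ), 0) w with hsd
    set s' := f.act (-(j : ℤ), 0) w' with hsd'
    obtain ⟨v, hv⟩ : ∃ v : ℤ × ℤ, v = ((j : ℤ) - i, k) := ⟨_, rfl⟩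
    have e1 : s = f.act v s' := by
      rw [hsd, hsd', hk, ← f.act_int, ← f.act_add, ← f.act_add, hv]
      congr 1
      ext <;> simp; ring
    have e2 : s' = f.act (-v) s := by
      rw [e1, ← f.act_add, neg_add_cancel, f.act_zero]
    have hi' := Finset.mem_range.1 (Finset.mem_coe.1 hi)
    have hj' := Finset.mem_range.1 (Finset.mem_coe.1 hj)
    -- An overlap of the i-th and j-th images yields two points of [y, σₙ y) that differ by some v
    -- with 0 < |v.1| < qₙ₊₁. Best approximation says that such a v moves points at least as far as
    -- σₙ.
    have hbest := theta_sigma_le_abs_theta hf (n := n) (v := v)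
      (by rw [hv]; simp only; omega) (by rw [hv, abs_lt]; simp only; omega)
    rcases le_abs.1 hbest with h | h
    · have h1 := act_le_act hf h s'
      have h2 := (f.strictMono_act (f.sigma n)).monotone hs'.1
      rw [← e1] at h1
      exact absurd hs.2 (not_lt.2 (h2.trans h1))
    · rw [← theta_neg] at h
      have h1 := act_le_act hf h s
      have h2 := (f.strictMono_act (f.sigma n)).monotone hs.1
      rw [← e2] at h1
      exact absurd hs'.2 (not_lt.2 (h2.trans h1))
  · exact fun i _ => measurableSet_coe_image_Ico _ _

/-- The interval from a to d is covered by m + 1 half-open fundamental intervals, to each of which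
disjointness applies. The extra one accounts for the closed right endpoint. -/
lemma sum_measure_iterate_Icc_le (n m : ℕ) {x a d : ℝ} (ha : x ≤ a)
    (hd : d ≤ f.act (m • f.sigma n) x) :
    ∑ i ∈ Finset.range (f.q (n + 1)), f.criticalMeasure.real ((fun t : ℝ => (t : UnitAddCircle)) ''
      Set.Icc (f.lift^[i] a) (f.lift^[i] d)) ≤ (m + 1) * f.criticalMeasure.real Set.univ := by
  have hcover : ∀ i, Set.Icc (f.lift^[i] a) (f.lift^[i] d) ⊆
      ⋃ j ∈ Finset.range (m + 1), Set.Ico (f.lift^[i] (f.act (j • f.sigma n) x))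
        (f.lift^[i] (f.act (f.sigma n) (f.act (j • f.sigma n) x))) := by
    intro i t ht
    have h0 : f.lift^[i] (f.act (0 • f.sigma n) x) ≤ t := by
      rw [zero_smul, f.act_zero]; exact ((f.strictMono_iterate i).monotone ha).trans ht.1
    have h1 : t < f.lift^[i] (f.act ((m + 1) • f.sigma n) x) := by
      refine ht.2.trans_lt (f.strictMono_iterate i (hd.trans_lt (f.act_lt_act ?_ x)))
      rw [theta_nsmul, theta_nsmul]
      have := theta_sigma_pos hf n
      push_cast; nlinarith
    have key : ∀ k : ℕ, t < f.lift^[i] (f.act (k • f.sigma n) x) → ∃ j < k,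
        f.lift^[i] (f.act (j • f.sigma n) x) ≤ t ∧
        t < f.lift^[i] (f.act ((j + 1) • f.sigma n) x) := by
      intro k
      induction k with
      | zero => exact fun h => absurd h0 (not_le.2 h)
      | succ k ih =>
        intro h
        rcases lt_or_ge t (f.lift^[i] (f.act (k • f.sigma n) x)) with h' | h'
        · obtain ⟨j, hj, h2⟩ := ih h'
          exact ⟨j, by omega, h2⟩
        · exact ⟨k, by omega, h', h⟩
    obtain ⟨j, hj, h2, h3⟩ := key _ h1
    refine Set.mem_biUnion (Finset.mem_coe.2 (Finset.mem_range.2 hj)) ⟨h2, ?_⟩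
    rwa [← f.act_add, ← succ_nsmul']
  calc _ ≤ ∑ i ∈ Finset.range (f.q (n + 1)), ∑ j ∈ Finset.range (m + 1),
        f.criticalMeasure.real ((fun t : ℝ => (t : UnitAddCircle)) ''
          Set.Ico (f.lift^[i] (f.act (j • f.sigma n) x))
            (f.lift^[i] (f.act (f.sigma n) (f.act (j • f.sigma n) x)))) := by
        refine Finset.sum_le_sum fun i _ => ?_
        refine (measureReal_mono ((Set.image_mono (hcover i)).trans ?_) (measure_ne_top _ _)).trans
          (measureReal_biUnion_finset_le _ _)
        rw [Set.image_iUnion₂]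
    _ = ∑ j ∈ Finset.range (m + 1), ∑ i ∈ Finset.range (f.q (n + 1)),
        f.criticalMeasure.real ((fun t : ℝ => (t : UnitAddCircle)) ''
          Set.Ico (f.lift^[i] (f.act (j • f.sigma n) x))
            (f.lift^[i] (f.act (f.sigma n) (f.act (j • f.sigma n) x)))) := Finset.sum_comm
    _ ≤ ∑ j ∈ Finset.range (m + 1), f.criticalMeasure.real Set.univ :=
        Finset.sum_le_sum fun j _ => sum_measure_iterate_Ico_le hf n _
    _ = _ := by simp

/-- The cross-ratio inequality for iterates up to the next return time. -/
lemma exists_crossRatio_iterate_le_of_le_q (m : ℕ) : ∃ B ≥ 1, ∀ n i : ℕ, i ≤ f.q (n + 1) →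
    ∀ x a b c d, x ≤ a → a < b → b < c → c < d → d ≤ f.act (m • f.sigma n) x →
      crossRatio (f.lift^[i] a) (f.lift^[i] b) (f.lift^[i] c) (f.lift^[i] d) ≤
        B * crossRatio a b c d := by
  obtain ⟨K, hK, h⟩ := f.exists_crossRatio_lift_le_exp_measure
  refine ⟨Real.exp (K * ((m + 1) * f.criticalMeasure.real Set.univ)), Real.one_le_exp
    (mul_nonneg hK (mul_nonneg (by positivity) measureReal_nonneg)),
    fun n i hi x a b c d hxa hab hbc hcd hd => ?_⟩
  have key : ∀ i, crossRatio (f.lift^[i] a) (f.lift^[i] b) (f.lift^[i] c) (f.lift^[i] d) ≤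
      Real.exp (K * ∑ l ∈ Finset.range i, f.criticalMeasure.real
        ((fun t : ℝ => (t : UnitAddCircle)) '' Set.Icc (f.lift^[l] a) (f.lift^[l] d))) *
        crossRatio a b c d := by
    intro i
    induction i with
    | zero => simp
    | succ i ih =>
      rw [Finset.sum_range_succ, mul_add, add_comm (K * _), Real.exp_add, mul_assoc]
      simp only [Function.iterate_succ_apply']
      exact (h _ _ _ _ (f.strictMono_iterate i hab) (f.strictMono_iterate i hbc)
        (f.strictMono_iterate i hcd)).trans (mul_le_mul_of_nonneg_left ih (Real.exp_pos _).le)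
  refine (key i).trans (mul_le_mul_of_nonneg_right ?_ (crossRatio_nonneg hab hbc hcd))
  refine Real.exp_le_exp.2 (mul_le_mul_of_nonneg_left ?_ hK)
  exact (Finset.sum_le_sum_of_subset_of_nonneg (Finset.range_mono hi)
    fun _ _ _ => measureReal_nonneg).trans (sum_measure_iterate_Icc_le hf n m hxa hd)

/-- The cross-ratio inequality for iterates up to twice the next return time. -/
lemma exists_crossRatio_iterate_le (m : ℕ) : ∃ B ≥ 1, ∀ n i : ℕ, i ≤ 2 * f.q (n + 1) →
    ∀ x a b c d, x ≤ a → a < b → b < c → c < d → d ≤ f.act (m • f.sigma n) x →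
      crossRatio (f.lift^[i] a) (f.lift^[i] b) (f.lift^[i] c) (f.lift^[i] d) ≤
        B * crossRatio a b c d := by
  obtain ⟨B, hB, h⟩ := exists_crossRatio_iterate_le_of_le_q hf m
  refine ⟨B * B, one_le_mul_of_one_le_of_one_le hB hB,
    fun n i hi x a b c d hxa hab hbc hcd hd => ?_⟩
  obtain ⟨j, k, hj, hk, rfl⟩ : ∃ j k, j ≤ f.q (n + 1) ∧ k ≤ f.q (n + 1) ∧ i = j + k :=
    ⟨min i (f.q (n + 1)), i - min i (f.q (n + 1)), by omega, by omega, by omega⟩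
  have h1 := h n k hk x a b c d hxa hab hbc hcd hd
  have h2 := h n j hj (f.lift^[k] x) _ _ _ _ ((f.strictMono_iterate k).monotone hxa)
    (f.strictMono_iterate k hab) (f.strictMono_iterate k hbc) (f.strictMono_iterate k hcd) (by
      rw [← f.act_natCast_zero k x, ← f.act_add, add_comm, f.act_add, f.act_natCast_zero]
      exact (f.strictMono_iterate k).monotone hd)
  simp only [Function.iterate_add_apply]
  calc _ ≤ B * _ := h2
    _ ≤ B * (B * crossRatio a b c d) := mul_le_mul_of_nonneg_left h1 (by linarith)
    _ = _ := by ring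

end Irrational

end MulticriticalCircleMap

/-! ### Comparability of adjacent fundamental intervals -/

lemma mul_le_of_le_crossRatio {p a b c d : ℝ} (hab : a < b) (hbc : b < c) (hcd : c < d)
    (h : p ≤ crossRatio a b c d) : p * (c - a) ≤ b - a ∧ p * (d - b) ≤ d - c :=
  ⟨(le_div_iff₀ (by linarith)).1 (h.trans (crossRatio_le_left hab hbc hcd)),
    (le_div_iff₀ (by linarith)).1 (h.trans (crossRatio_le_right hab hbc hcd))⟩

/-- With `mul_le_of_le_crossRatio` this translates between cross-ratios bounded below and end
intervals that are not too short. Upper distortion bounds thus pull space back from an image to its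
source. -/
lemma mul_le_crossRatio {p p' a b c d : ℝ} (hp' : 0 ≤ p') (hab : a < b)
    (hbc : b < c) (hcd : c < d) (h : p * (c - a) ≤ b - a) (h' : p' * (d - b) ≤ d - c) :
    p * p' ≤ crossRatio a b c d := by
  rw [crossRatio_eq_mul]
  exact mul_le_mul ((le_div_iff₀ (by linarith)).2 h) ((le_div_iff₀ (by linarith)).2 h') hp'
    (div_nonneg (by linarith) (by linarith))

namespace MulticriticalCircleMap

variable (f : MulticriticalCircleMap)

/-- The length of the fundamental interval `[x, σₙ x]`. -/
def gap (n : ℕ) (x : ℝ) : ℝ := f.act (f.sigma n) x - x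

/-- The points `x` and `y` differ by at most `k` steps of `σₙ`. -/
def Near (k n : ℕ) (x y : ℝ) : Prop :=
  y ≤ f.act (k • f.sigma n) x ∧ x ≤ f.act (k • f.sigma n) y

lemma act_comm (v w : ℤ × ℤ) (x : ℝ) : f.act v (f.act w x) = f.act w (f.act v x) := by
  rw [← f.act_add, add_comm, f.act_add]

lemma act_neg_act (v : ℤ × ℤ) (x : ℝ) : f.act (-v) (f.act v x) = x := by
  rw [← f.act_add, neg_add_cancel, f.act_zero]

lemma act_act_neg (v : ℤ × ℤ) (x : ℝ) : f.act v (f.act (-v) x) = x := by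
  rw [← f.act_add, add_neg_cancel, f.act_zero]

lemma gap_add_int (n : ℕ) (x : ℝ) (k : ℤ) : f.gap n (x + k) = f.gap n x := by
  rw [gap, f.act_add_int, gap]; ring

variable {f}

lemma Near.symm {k n : ℕ} {x y : ℝ} (h : f.Near k n x y) : f.Near k n y x := ⟨h.2, h.1⟩

lemma Near.act {k n : ℕ} {x y : ℝ} (h : f.Near k n x y) (v : ℤ × ℤ) :
    f.Near k n (f.act v x) (f.act v y) := by
  constructor
  · rw [f.act_comm]; exact (f.strictMono_act v).monotone h.1
  · rw [f.act_comm]; exact (f.strictMono_act v).monotone h.2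

lemma Near.iterate {k n : ℕ} {x y : ℝ} (h : f.Near k n x y) (i : ℕ) :
    f.Near k n (f.lift^[i] x) (f.lift^[i] y) := by
  rw [← f.act_natCast_zero, ← f.act_natCast_zero]; exact h.act _

lemma Near.trans {k l n : ℕ} {x y z : ℝ} (h : f.Near k n x y) (h' : f.Near l n y z) :
    f.Near (k + l) n x z := by
  constructor
  · rw [add_comm, add_smul, f.act_add]
    exact h'.1.trans ((f.strictMono_act _).monotone h.1)
  · rw [add_smul, f.act_add]
    exact h.2.trans ((f.strictMono_act _).monotone h'.2)

variable (hf : Function.periodicPts f.toHomeomorph = ∅)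

include hf

lemma lt_act_sigma (n : ℕ) (x : ℝ) : x < f.act (f.sigma n) x :=
  f.lt_act_of_theta_pos (theta_sigma_pos hf n) x

lemma act_neg_sigma_lt (n : ℕ) (x : ℝ) : f.act (-f.sigma n) x < x := by
  conv_rhs => rw [← f.act_act_neg (f.sigma n) x]
  exact lt_act_sigma hf n _

lemma gap_pos (n : ℕ) (x : ℝ) : 0 < f.gap n x := sub_pos.2 (lt_act_sigma hf n x)

lemma gap_lt_one (n : ℕ) (x : ℝ) : f.gap n x < 1 := by
  have h : f.act (f.sigma n) x < f.act (0, 1) x :=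
    f.act_lt_act (by rw [f.theta_int]; simpa using theta_sigma_lt_one hf n) x
  rw [f.act_int] at h
  rw [gap]; push_cast at h; linarith

lemma Near.mono {k l n : ℕ} {x y : ℝ} (h : f.Near k n x y) (hkl : k ≤ l) : f.Near l n x y := by
  have : f.theta (k • f.sigma n) ≤ f.theta (l • f.sigma n) := by
    rw [theta_nsmul, theta_nsmul]
    exact mul_le_mul_of_nonneg_right (by exact_mod_cast hkl) (theta_sigma_pos hf n).le
  exact ⟨h.1.trans (act_le_act hf this x), h.2.trans (act_le_act hf this y)⟩

lemma Near.of_succ {k n : ℕ} {x y : ℝ} (h : f.Near k (n + 1) x y) : f.Near k n x y := by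
  have : f.theta (k • f.sigma (n + 1)) ≤ f.theta (k • f.sigma n) := by
    rw [theta_nsmul, theta_nsmul]
    exact mul_le_mul_of_nonneg_left (theta_sigma_succ_lt hf n).le (Nat.cast_nonneg k)
  exact ⟨h.1.trans (act_le_act hf this x), h.2.trans (act_le_act hf this y)⟩

lemma near_one_of_mem {n : ℕ} {x y : ℝ} (h₁ : x ≤ y) (h₂ : y ≤ f.act (f.sigma n) x) :
    f.Near 1 n x y := by
  constructor
  · rwa [one_smul]
  · rw [one_smul]; exact h₁.trans (lt_act_sigma hf n y).le

omit hf in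
lemma near_one_of_mem_Icc {n : ℕ} {x y : ℝ}
    (h : y ∈ Set.Icc (f.act (-f.sigma n) x) (f.act (f.sigma n) x)) : f.Near 1 n x y := by
  constructor
  · rw [one_smul]; exact h.2
  · rw [one_smul, ← f.act_act_neg (f.sigma n) x]; exact (f.strictMono_act _).monotone h.1

lemma near_act_sigma (n : ℕ) (x : ℝ) : f.Near 1 n x (f.act (f.sigma n) x) :=
  near_one_of_mem hf (lt_act_sigma hf n x).le le_rfl

lemma near_act_neg_sigma (n : ℕ) (x : ℝ) : f.Near 1 n x (f.act (-f.sigma n) x) := by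
  have := (near_act_sigma hf n (f.act (-f.sigma n) x)).symm
  rwa [f.act_act_neg] at this

omit hf in
lemma exists_q_eq_sigma (n : ℕ) :
    ∃ p : ℤ, ((f.q n : ℤ), p) = f.sigma n ∨ ((f.q n : ℤ), p) = -f.sigma n := by
  have h := (f.sigma_fst n).1
  rcases neg_one_pow_eq_or ℤ n with h' | h'
  · exact ⟨(f.sigma n).2, Or.inl (Prod.ext (by rw [h, h']; simp) rfl)⟩
  · exact ⟨-(f.sigma n).2, Or.inr (Prod.ext (by simp [h, h']) rfl)⟩

lemma exists_near_act_q (n : ℕ) : ∃ p : ℤ, ∀ x, f.Near 1 n x (f.act ((f.q n : ℤ), p) x) := by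
  obtain ⟨p, hp | hp⟩ := exists_q_eq_sigma (f := f) n
  · exact ⟨p, fun x => hp ▸ near_act_sigma hf n x⟩
  · exact ⟨p, fun x => hp ▸ near_act_neg_sigma hf n x⟩

/-- The cross-ratio inequality for iterates, composed with integer translations. -/
lemma exists_crossRatio_act_le (m : ℕ) : ∃ B ≥ 1, ∀ n i : ℕ, i ≤ 2 * f.q (n + 1) → ∀ p : ℤ,
    ∀ x a b c d, x ≤ a → a < b → b < c → c < d → d ≤ f.act (m • f.sigma n) x →
      crossRatio (f.act (i, p) a) (f.act (i, p) b) (f.act (i, p) c) (f.act (i, p) d) ≤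
        B * crossRatio a b c d := by
  obtain ⟨B, hB, h⟩ := exists_crossRatio_iterate_le hf m
  refine ⟨B, hB, fun n i hi p x a b c d hxa hab hbc hcd hd => ?_⟩
  have := h n i hi x a b c d hxa hab hbc hcd hd
  simpa only [crossRatio, act_natCast, add_sub_add_right_eq_sub] using this

-- By periodicity the minimum over one period is global. A shortest fundamental interval
-- automatically has neighbours at least as long as itself.
omit hf in
lemma exists_gap_min (n : ℕ) : ∃ z, ∀ x, f.gap n z ≤ f.gap n x := by
  obtain ⟨z, -, hz⟩ := isCompact_Icc.exists_isMinOn (s := Set.Icc (0 : ℝ) 1) ⟨0, by simp⟩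
    (f := f.gap n) ((f.continuous_act (f.sigma n)).sub continuous_id).continuousOn
  refine ⟨z, fun x => ?_⟩
  have h1 : f.gap n z ≤ f.gap n (Int.fract x) :=
    hz (⟨Int.fract_nonneg x, (Int.fract_lt_one x).le⟩ : Int.fract x ∈ Set.Icc (0 : ℝ) 1)
  have h2 := f.gap_add_int n (Int.fract x) ⌊x⌋
  rw [Int.fract_add_floor] at h2
  rwa [h2]

/-- If the neighbours of the image of a fundamental interval are not too short, then neither are
the neighbours of the interval. -/
lemma exists_pull_back_space : ∃ B ≥ 1, ∀ n i : ℕ, i ≤ 2 * f.q (n + 1) → ∀ p : ℤ, ∀ x : ℝ,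
    ∀ M ≥ 1, (∀ y, f.gap n (f.act (i, p) (f.act (f.sigma n) x)) ≤ M * f.gap n y) →
      f.gap n (f.act (f.sigma n) x) ≤ B * M ^ 2 * f.gap n x ∧
      f.gap n (f.act (f.sigma n) x) ≤
        B * M ^ 2 * f.gap n (f.act (f.sigma n) (f.act (f.sigma n) x)) := by
  obtain ⟨B, hB, h⟩ := exists_crossRatio_act_le hf 3
  refine ⟨B * 4, by linarith, fun n i hi p x M hM hgap => ?_⟩
  set s := f.sigma n
  have e3 : f.act (3 • s) x = f.act s (f.act s (f.act s x)) := by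
    rw [← f.act_add, ← f.act_add]; congr 1; abel
  have l := lt_act_sigma hf n
  have hcr := h n i hi p x x (f.act s x) (f.act s (f.act s x)) (f.act s (f.act s (f.act s x)))
    le_rfl (l _) (l _) (l _) e3.ge
  set y := f.act (i, p) x with hy
  have hcomm : ∀ z, f.act (i, p) (f.act s z) = f.act s (f.act (i, p) z) := f.act_comm _ _
  simp only [hcomm, ← hy] at hcr hgap
  have g0 := hgap y
  have g1 := hgap (f.act s (f.act s y))
  simp only [gap] at g0 g1
  have p0 := l y
  have p1 := l (f.act s y)
  have p2 := l (f.act s (f.act s y))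
  have p0' := l x
  have p1' := l (f.act s x)
  have p2' := l (f.act s (f.act s x))
  have hM0 : (0 : ℝ) < 2 * M := by linarith
  -- Each end interval of the image is at least 1/M times the middle one, so it fills a proportion
  -- of at least 1/(1 + M) ≥ 1/(2M) of its union with the middle one.
  have hlow := mul_le_crossRatio (p := 1 / (2 * M)) (p' := 1 / (2 * M)) (by positivity) p0 p1 p2
    (by rw [one_div_mul_eq_div, div_le_iff₀ hM0]; nlinarith)
    (by rw [one_div_mul_eq_div, div_le_iff₀ hM0]; nlinarith)
  have hlow' : 1 / (B * (4 * M ^ 2)) ≤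
      crossRatio x (f.act s x) (f.act s (f.act s x)) (f.act s (f.act s (f.act s x))) := by
    rw [div_le_iff₀ (by positivity)]
    have e : 1 / (2 * M) * (1 / (2 * M)) * (4 * M ^ 2) = 1 := by field_simp; norm_num
    have := mul_le_mul_of_nonneg_right (hlow.trans hcr) (show 0 ≤ 4 * M ^ 2 by positivity)
    rw [e] at this
    linarith
  obtain ⟨k1, k2⟩ := mul_le_of_le_crossRatio p0' p1' p2' hlow'
  rw [one_div_mul_eq_div, div_le_iff₀ (by positivity)] at k1 k2
  simp only [gap]
  constructor <;> linarith

/-- Consecutive fundamental intervals are comparable, around every point. -/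
lemma exists_gap_le : ∃ C ≥ 1, ∀ n x, f.gap n (f.act (f.sigma n) x) ≤ C * f.gap n x ∧
    f.gap n x ≤ C * f.gap n (f.act (f.sigma n) x) := by
  obtain ⟨B, hB, h⟩ := exists_pull_back_space hf
  -- Some [v, σₙ² v] consists of two intervals comparable to the shortest one, so every fundamental
  -- interval starting in [v, σₙ v] is almost minimal.
  have hmid : ∀ n, ∃ v, ∀ w, v ≤ w → w ≤ f.act (f.sigma n) v → ∀ y,
      f.gap n w ≤ (1 + B) * f.gap n y := by
    intro n
    obtain ⟨z, hz⟩ := exists_gap_min (f := f) n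
    have hq := q_le_q_succ hf n
    have key : ∃ v, f.gap n v + f.gap n (f.act (f.sigma n) v) ≤ (1 + B) * f.gap n z := by
      -- The iterate f^{qₙ} acts as σₙ or as its inverse. In either case it carries one neighbour of
      -- the minimal interval onto it, so that neighbour has space around it and is comparable: the
      -- left neighbour if it acts as σₙ, the right one otherwise.
      obtain ⟨p, hp | hp⟩ := exists_q_eq_sigma (f := f) n
      · refine ⟨f.act (-f.sigma n) z, ?_⟩
        have := (h n (f.q n) (by omega) p (f.act (-f.sigma n) (f.act (-f.sigma n) z)) 1 le_rfl
          (by rw [hp, f.act_act_neg, f.act_act_neg]; simpa using hz)).2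
        rw [f.act_act_neg, f.act_act_neg] at this
        rw [f.act_act_neg]
        linarith
      · refine ⟨z, ?_⟩
        have := (h n (f.q n) (by omega) p z 1 le_rfl
          (by rw [hp, f.act_neg_act]; simpa using hz)).1
        linarith
    obtain ⟨v, hv⟩ := key
    refine ⟨v, fun w hw hw' y => ?_⟩
    have h1 := (f.strictMono_act (f.sigma n)).monotone hw'
    have h2 : f.gap n w ≤ f.gap n v + f.gap n (f.act (f.sigma n) v) := by
      simp only [gap]; linarith
    exact h2.trans (hv.trans (mul_le_mul_of_nonneg_left (hz y) (by linarith)))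
  have h1B : 1 ≤ 1 + B := by linarith
  refine ⟨B * (1 + B) ^ 2, one_le_mul_of_one_le_of_one_le hB (one_le_pow₀ h1B), fun n x => ?_⟩
  have key : ∀ x, f.gap n (f.act (f.sigma n) x) ≤ B * (1 + B) ^ 2 * f.gap n x ∧
      f.gap n (f.act (f.sigma n) x) ≤
        B * (1 + B) ^ 2 * f.gap n (f.act (f.sigma n) (f.act (f.sigma n) x)) := by
    intro x
    obtain ⟨v, hv⟩ := hmid n
    obtain ⟨i, hi, p, hip⟩ := exists_act_mem_Ico hf n (f.act (f.sigma n) x) v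
    have hq := q_le_q_succ hf n
    exact h n i (by omega) p x (1 + B) h1B fun y => hv _ hip.1 hip.2.le y
  refine ⟨(key x).1, ?_⟩
  have := (key (f.act (-f.sigma n) x)).2
  rwa [f.act_act_neg] at this

/-- Induction on the number of steps. An intermediate point y of [u, σₙ u] is handled because [y, σₙ
y] lies in the two intervals that start at u and σₙ u, while [u, σₙ u] lies in those that start at
σₙ⁻¹ y and y. -/
lemma exists_gap_le_of_near (k : ℕ) :
    ∃ C ≥ 1, ∀ n x y, f.Near k n x y → f.gap n y ≤ C * f.gap n x := by
  obtain ⟨C, hC, h⟩ := exists_gap_le hf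
  have key : ∀ k : ℕ, ∃ D ≥ 1, ∀ n x y, x ≤ y → y ≤ f.act (k • f.sigma n) x →
      f.gap n y ≤ D * f.gap n x ∧ f.gap n x ≤ D * f.gap n y := by
    intro k
    induction k with
    | zero =>
      refine ⟨1, le_rfl, fun n x y hxy hyx => ?_⟩
      rw [zero_smul, f.act_zero] at hyx
      rw [le_antisymm hxy hyx]
      simp
    | succ k ih =>
      obtain ⟨D, hD, ih⟩ := ih
      refine ⟨(1 + C) * D, one_le_mul_of_one_le_of_one_le (by linarith) hD,
        fun n x y hxy hyx => ?_⟩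
      have hpx := gap_pos hf n x
      have hpy := gap_pos hf n y
      rcases le_total y (f.act (k • f.sigma n) x) with hy | hy
      · obtain ⟨h1, h2⟩ := ih n x y hxy hy
        have h3 : D ≤ (1 + C) * D := by nlinarith
        exact ⟨h1.trans (mul_le_mul_of_nonneg_right h3 hpx.le),
          h2.trans (mul_le_mul_of_nonneg_right h3 hpy.le)⟩
      · obtain ⟨u, hu⟩ : ∃ u, u = f.act (k • f.sigma n) x := ⟨_, rfl⟩
        rw [succ_nsmul', f.act_add, ← hu] at hyx
        rw [← hu] at hy
        have hxu : x ≤ u := by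
          rw [hu]
          have := act_le_act hf (v := 0) (w := k • f.sigma n) (by
            rw [theta_nsmul]
            have := theta_sigma_pos hf n
            simp only [theta, Prod.fst_zero, Prod.snd_zero, Int.cast_zero, zero_mul, add_zero]
            positivity) x
          rwa [f.act_zero] at this
        obtain ⟨h1, h2⟩ := ih n x u hxu hu.le
        have h3 := (f.strictMono_act (f.sigma n)).monotone hyx
        have h4 := (f.strictMono_act (f.sigma n)).monotone hy
        have h5 := (h n u).1
        have h6 := (h n (f.act (-f.sigma n) y)).1
        have h6' := (h n (f.act (-f.sigma n) y)).2
        have h7 := (f.strictMono_act (-f.sigma n)).monotone hyx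
        rw [f.act_neg_act] at h7
        simp only [gap, f.act_act_neg] at h1 h2 h5 h6 h6' ⊢
        have k1 : f.act (f.sigma n) y - y ≤ (1 + C) * (f.act (f.sigma n) u - u) := by linarith
        have k2 : f.act (f.sigma n) u - u ≤ (1 + C) * (f.act (f.sigma n) y - y) := by linarith
        constructor
        · calc _ ≤ _ := k1
            _ ≤ _ := mul_le_mul_of_nonneg_left h1 (by linarith)
            _ = _ := by ring
        · calc _ ≤ _ := h2
            _ ≤ _ := mul_le_mul_of_nonneg_left k2 (by linarith)
            _ = _ := by ring
  obtain ⟨D, hD, h⟩ := key k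
  refine ⟨D, hD, fun n x y hxy => ?_⟩
  rcases le_total x y with hle | hle
  · exact (h n x y hle hxy.1).1
  · exact (h n y x hle hxy.2).2

/-! ### Comparability of consecutive levels near critical orbits -/

omit hf in
lemma act_natCast_succ {k : ℕ} (hk : 1 ≤ k) (p : ℤ) (x : ℝ) :
    f.act ((k : ℤ), p) x = f.act (((k - 1 : ℕ) : ℤ), p) (f.lift x) := by
  rw [act_natCast, act_natCast, ← Function.iterate_succ_apply, Nat.succ_eq_add_one,
    Nat.sub_add_cancel hk]

/-- At a critical point the fundamental intervals of consecutive levels are comparable. -/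
lemma exists_gap_le_gap_succ_of_critical : ∃ C ≥ 1, ∀ n c, deriv f.lift c = 0 →
    f.gap n c ≤ C * f.gap (n + 1) c := by
  obtain ⟨B, hB, hcr⟩ := exists_crossRatio_act_le hf 2
  obtain ⟨C, hC, hnear⟩ := exists_gap_le_of_near hf 1
  -- `D` collects all losses on the way back to a neighbourhood of c; the 2 in η = 1/(2D) makes the
  -- final comparison contradictory.
  obtain ⟨D, hD⟩ : ∃ D, D = B * (C * C * (1 + C)) := ⟨_, rfl⟩
  have hD0 : 0 < D := by rw [hD]; positivity
  obtain ⟨ε, hε, hcontr⟩ := f.exists_critical_contraction (η := 1 / (2 * D)) (by positivity)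
  refine ⟨max 1 ε⁻¹, le_max_left _ _, fun n c hc => ?_⟩
  have hu := gap_pos hf (n + 1) c
  have hv := gap_pos hf n c
  obtain ⟨u, hu'⟩ : ∃ u, u = f.gap (n + 1) c := ⟨_, rfl⟩
  obtain ⟨v, hv'⟩ : ∃ v, v = f.gap n c := ⟨_, rfl⟩
  rw [← hu'] at hu ⊢
  rw [← hv'] at hv ⊢
  suffices h : ε * v < u by
    have h1 : v ≤ ε⁻¹ * u := by
      rw [← div_eq_inv_mul, le_div_iff₀ hε]; linarith
    exact h1.trans (mul_le_mul_of_nonneg_right (le_max_right _ _) hu.le)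
  by_contra hle
  push Not at hle
  have h1 := hcontr c hc u v hu hv (hv' ▸ (gap_lt_one hf n c).le) hle
  have eu : c + u = f.act (f.sigma (n + 1)) c := by rw [hu', gap]; ring
  have ev : c + v = f.act (f.sigma n) c := by rw [hv', gap]; ring
  rw [eu, ev] at h1
  set s := f.sigma n with hs
  set t := f.sigma (n + 1) with ht
  obtain ⟨p, hp⟩ := exists_near_act_q hf (n + 1)
  obtain ⟨w, hw⟩ : ∃ w, w = f.act ((f.q (n + 1) : ℤ), p) c := ⟨_, rfl⟩
  have hwc : f.Near 1 (n + 1) c w := hw ▸ hp c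
  have hwc' := hwc.of_succ hf
  have hlift : ∀ v x, f.lift (f.act v x) = f.act v (f.lift x) := by
    intro v x
    have := f.act_comm ((1 : ℕ), 0) v x
    simpa only [f.act_natCast_zero, Function.iterate_one] using this
  have hst : ∀ x, f.act t x < f.act s x := fun x => f.act_lt_act (theta_sigma_succ_lt hf n) x
  have e2 : ∀ x, f.act (2 • s) x = f.act s (f.act s x) := by
    intro x; rw [two_smul, f.act_add]
  have hq := (one_le_q hf n).2
  -- The critical iterate is split off and treated by the contraction estimate. The cross-ratio
  -- inequality is applied only to the remaining qₙ₊₁ - 1 iterates, which start at the critical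
  -- value.
  have hineq := hcr n (f.q (n + 1) - 1) (by omega) p (f.lift c) (f.lift c) (f.lift (f.act t c))
    (f.lift (f.act s c)) (f.lift (f.act s (f.act s c))) le_rfl
    (f.strictMono_lift (lt_act_sigma hf (n + 1) c)) (f.strictMono_lift (hst c))
    (f.strictMono_lift (lt_act_sigma hf n _)) (by rw [← hs, e2, hlift, hlift])
  rw [← act_natCast_succ hq, ← act_natCast_succ hq, ← act_natCast_succ hq,
    ← act_natCast_succ hq, f.act_comm _ t, f.act_comm _ s, f.act_comm _ s, f.act_comm _ s,
    ← hw] at hineq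
  have hup := crossRatio_le_left (f.strictMono_lift (lt_act_sigma hf (n + 1) c))
    (f.strictMono_lift (hst c)) (f.strictMono_lift (lt_act_sigma hf n (f.act s c)))
  have hFpos : 0 < f.lift (f.act s c) - f.lift c :=
    sub_pos.2 (f.strictMono_lift (lt_act_sigma hf n c))
  have hup' : (f.lift (f.act t c) - f.lift c) / (f.lift (f.act s c) - f.lift c) ≤
      1 / (2 * D) * (u / v) := by
    rw [← mul_div_assoc, div_le_div_iff₀ hFpos hv]
    linarith
  have g1 : u ≤ C * f.gap (n + 1) w := hu' ▸ hnear (n + 1) w c hwc.symm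
  have g2 : f.gap n w ≤ C * v := hv' ▸ hnear n c w hwc'
  have g3 : f.gap n w ≤ C * f.gap n (f.act s w) := hnear n _ _ (near_act_sigma hf n w).symm
  -- The return point w is one step of level n + 1 away from c, so both gaps at w are comparable to
  -- those at c and their ratio is still at least u/(C²v).
  have hlow := mul_le_crossRatio (p := u / (C * C * v)) (p' := 1 / (1 + C)) (by positivity)
    (lt_act_sigma hf (n + 1) w) (hst w) (lt_act_sigma hf n (f.act s w))
    (by
      rw [div_mul_eq_mul_div, div_le_iff₀ (by positivity)]
      change u * f.gap n w ≤ f.gap (n + 1) w * _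
      calc u * f.gap n w ≤ (C * f.gap (n + 1) w) * (C * v) :=
            mul_le_mul g1 g2 (gap_pos hf n w).le
              (mul_nonneg (by linarith) (gap_pos hf (n + 1) w).le)
        _ = _ := by ring)
    (by
      rw [one_div_mul_eq_div, div_le_iff₀ (by linarith)]
      have h2 := lt_act_sigma hf (n + 1) w
      simp only [gap] at g3
      linarith)
  have hfin : u / (C * C * v) * (1 / (1 + C)) ≤ B * (1 / (2 * D) * (u / v)) :=
    hlow.trans (hineq.trans (mul_le_mul_of_nonneg_left (hup.trans hup') (by linarith)))
  have e : B * (1 / (2 * D) * (u / v)) = 1 / 2 * (u / (C * C * v) * (1 / (1 + C))) := by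
    rw [hD]; field_simp
  rw [e] at hfin
  have : 0 < u / (C * C * v) * (1 / (1 + C)) := by positivity
  linarith

/-- Lower bounds for relative lengths can be pulled back by iterates. -/
lemma exists_pull_back_length : ∃ C ≥ 1, ∀ n i : ℕ, i ≤ 2 * f.q (n + 1) → ∀ p : ℤ, ∀ x s t M,
    1 ≤ M → f.act (-f.sigma n) x ≤ s → s < t → t ≤ f.act (f.sigma n) x →
    f.gap n (f.act (i, p) x) ≤ M * (f.act (i, p) t - f.act (i, p) s) →
      f.gap n x ≤ C * M * (t - s) := by
  obtain ⟨B, hB, hcr⟩ := exists_crossRatio_act_le hf 4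
  obtain ⟨C, hC, hnear⟩ := exists_gap_le_of_near hf 1
  obtain ⟨D, hD⟩ : ∃ D, D = C + 1 + C + C ^ 2 := ⟨_, rfl⟩
  have hD1 : 1 ≤ D := by rw [hD]; nlinarith
  refine ⟨B * (D * (D * C)) * C, ?_, fun n i hi p x s t M hM hs hst ht hlen => ?_⟩
  · refine one_le_mul_of_one_le_of_one_le (one_le_mul_of_one_le_of_one_le hB ?_) hC
    exact one_le_mul_of_one_le_of_one_le hD1 (one_le_mul_of_one_le_of_one_le hD1 hC)
  set g := f.sigma n with hg
  have l := lt_act_sigma hf n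
  have e4 : f.act (4 • g) (f.act (-g) x) = f.act g (f.act g (f.act g x)) := by
    rw [← f.act_add, ← f.act_add, ← f.act_add]; congr 1; abel
  -- The right interval is [σₙ² x, σₙ³ x], and the middle one contains [σₙ x, σₙ² x] even if t is as
  -- far right as possible. The four points lie within four steps of σₙ⁻¹ x.
  have hineq := hcr n i hi p (f.act (-g) x) s t (f.act g (f.act g x))
    (f.act g (f.act g (f.act g x))) hs hst (ht.trans_lt (l _)) (l _) (by rw [← hg, e4])
  set A := f.act (i, p) with hA
  have mA : StrictMono A := f.strictMono_act _
  have hcomm : ∀ z, A (f.act g z) = f.act g (A z) := f.act_comm _ _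
  obtain ⟨y, hy⟩ : ∃ y, y = A x := ⟨_, rfl⟩
  simp only [hcomm, ← hy] at hineq hlen
  have hAs : f.act (-g) y ≤ A s := by
    rw [hy, hA, f.act_comm]; exact mA.monotone hs
  have hAt : A t ≤ f.act g y := by
    rw [hy, hA, f.act_comm]; exact mA.monotone ht
  have g0 : f.gap n (f.act (-g) y) ≤ C * f.gap n y := hnear n _ _ (near_act_neg_sigma hf n y)
  have g1 : f.gap n (f.act g y) ≤ C * f.gap n y := hnear n _ _ (near_act_sigma hf n y)
  have g2 : f.gap n (f.act g (f.act g y)) ≤ C * f.gap n (f.act g y) :=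
    hnear n _ _ (near_act_sigma hf n _)
  have g3 : f.gap n y ≤ C * f.gap n (f.act g y) := hnear n _ _ (near_act_sigma hf n y).symm
  have g4 : f.gap n (f.act g y) ≤ C * f.gap n (f.act g (f.act g y)) :=
    hnear n _ _ (near_act_sigma hf n _).symm
  have hpy := gap_pos hf n y
  have hpy1 := gap_pos hf n (f.act g y)
  have hpy2 := gap_pos hf n (f.act g (f.act g y))
  have hM0 : 0 < M := by linarith
  have hAst : A s < A t := mA hst
  have b1 : f.act g (f.act g y) - A s ≤ D * f.gap n y := by
    have : f.act g (f.act g y) - A s ≤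
        f.gap n (f.act g y) + f.gap n y + f.gap n (f.act (-g) y) := by
      simp only [gap, ← hg, f.act_act_neg]; linarith
    rw [hD]; nlinarith
  have b2 : f.act g (f.act g (f.act g y)) - A t ≤ D * C * f.gap n (f.act g (f.act g y)) := by
    have h1 : f.act g (f.act g (f.act g y)) - A t ≤ f.gap n (f.act g (f.act g y)) +
        f.gap n (f.act g y) + f.gap n y + f.gap n (f.act (-g) y) := by
      simp only [gap, ← hg, f.act_act_neg]; linarith
    have h2 : f.gap n (f.act g (f.act g y)) + f.gap n (f.act g y) + f.gap n y +
        f.gap n (f.act (-g) y) ≤ f.gap n (f.act g (f.act g y)) + f.gap n (f.act g y) +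
          (1 + C) * (C * f.gap n (f.act g y)) := by nlinarith
    have h3 : f.gap n (f.act g (f.act g y)) + f.gap n (f.act g y) +
          (1 + C) * (C * f.gap n (f.act g y)) ≤ f.gap n (f.act g (f.act g y)) +
          (1 + (1 + C) * C) * (C * f.gap n (f.act g (f.act g y))) := by nlinarith
    have h4 : f.gap n (f.act g (f.act g y)) ≤ C * (C * f.gap n (f.act g (f.act g y))) := by
      nlinarith
    refine h1.trans (h2.trans (h3.trans ?_))
    rw [hD]; nlinarith
  have hlow := mul_le_crossRatio (p := 1 / (D * M)) (p' := 1 / (D * C)) (by positivity)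
    hAst (hAt.trans_lt (l _)) (l (f.act g (f.act g y)))
    (by
      rw [one_div_mul_eq_div, div_le_iff₀ (by positivity)]
      calc _ ≤ D * f.gap n y := b1
        _ ≤ D * (M * (A t - A s)) := mul_le_mul_of_nonneg_left hlen (by linarith)
        _ = _ := by ring)
    (by
      rw [one_div_mul_eq_div, div_le_iff₀ (by positivity)]
      exact b2.trans (le_of_eq (mul_comm _ _)))
  have hup := crossRatio_le_left hst (ht.trans_lt (l _)) (l (f.act g (f.act g x)))
  have hgx : f.gap n x ≤ C * f.gap n (f.act g x) := hnear n _ _ (near_act_sigma hf n x).symm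
  have hgx' : f.gap n (f.act g x) ≤ f.act g (f.act g x) - s := by
    simp only [gap, ← hg]; linarith
  have hpos := gap_pos hf n (f.act g x)
  have hup2 : (t - s) / (f.act g (f.act g x) - s) ≤ (t - s) / f.gap n (f.act g x) :=
    div_le_div_of_nonneg_left (by linarith) hpos hgx'
  have hfin := hlow.trans (hineq.trans (mul_le_mul_of_nonneg_left (hup.trans hup2)
    (by linarith)))
  have hfin2 : f.gap n (f.act g x) ≤ B * (D * (D * C)) * M * (t - s) := by
    rw [← mul_div_assoc B, le_div_iff₀ hpos] at hfin
    have e : f.gap n (f.act g x) =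
        (D * M) * (D * C) * (1 / (D * M) * (1 / (D * C)) * f.gap n (f.act g x)) := by
      field_simp
    rw [e]
    calc _ ≤ (D * M) * (D * C) * (B * (t - s)) :=
          mul_le_mul_of_nonneg_left hfin (by positivity)
      _ = _ := by ring
  calc f.gap n x ≤ C * f.gap n (f.act g x) := hgx
    _ ≤ C * (B * (D * (D * C)) * M * (t - s)) := mul_le_mul_of_nonneg_left hfin2 (by linarith)
    _ = _ := by ring

/-- Fundamental intervals of consecutive levels are comparable at all points that are mapped close
to a critical point. -/
lemma exists_gap_le_gap_succ_of_near_critical : ∃ C ≥ 1, ∀ n c, deriv f.lift c = 0 →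
    ∀ i : ℕ, i ≤ 2 * f.q (n + 1) → ∀ (p : ℤ) (y : ℝ), f.Near 3 (n + 1) c (f.act (i, p) y) →
      f.gap n y ≤ C * f.gap (n + 1) y := by
  obtain ⟨C₁, hC₁, hcrit⟩ := exists_gap_le_gap_succ_of_critical hf
  obtain ⟨C₂, hC₂, hnear⟩ := exists_gap_le_of_near hf 3
  obtain ⟨C₃, hC₃, hpull⟩ := exists_pull_back_length hf
  have hM : 1 ≤ C₂ * (C₁ * C₂) :=
    one_le_mul_of_one_le_of_one_le hC₂ (one_le_mul_of_one_le_of_one_le hC₁ hC₂)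
  refine ⟨C₃ * (C₂ * (C₁ * C₂)), one_le_mul_of_one_le_of_one_le hC₃ hM,
    fun n c hc i hi p y hy => ?_⟩
  refine hpull n i hi p y y (f.act (f.sigma (n + 1)) y) _ hM (act_neg_sigma_lt hf n y).le
    (lt_act_sigma hf (n + 1) y) (f.act_lt_act (theta_sigma_succ_lt hf n) y).le ?_
  rw [f.act_comm _ (f.sigma (n + 1))]
  change _ ≤ _ * f.gap (n + 1) _
  set w := f.act (i, p) y
  have h1 := hnear n _ _ (hy.of_succ hf)
  have h2 := hcrit n c hc
  have h3 := hnear (n + 1) _ _ hy.symm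
  calc f.gap n w ≤ C₂ * f.gap n c := h1
    _ ≤ C₂ * (C₁ * (C₂ * f.gap (n + 1) w)) := by gcongr; exact h2.trans (by gcongr)
    _ = _ := by ring

/-- Fundamental intervals of consecutive levels are comparable along the first part of the orbit of
a critical point. -/
lemma exists_gap_le_gap_succ_of_orbit : ∃ C ≥ 1, ∀ n c, deriv f.lift c = 0 →
    ∀ l : ℕ, l ≤ 2 * f.q (n + 1) → ∀ z, f.Near 1 (n + 1) c z →
      f.gap n (f.lift^[l] z) ≤ C * f.gap (n + 1) (f.lift^[l] z) := by
  obtain ⟨C, hC, h⟩ := exists_gap_le_gap_succ_of_near_critical hf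
  refine ⟨C, hC, fun n c hc l hl z hz => ?_⟩
  obtain ⟨p, hp⟩ := exists_near_act_q hf (n + 1)
  refine h n c hc (2 * f.q (n + 1) - l) (by omega) (p + p) _ ?_
  -- After l iterates there remain 2qₙ₊₁ - l until the second return. Each return moves by one step
  -- of level n + 1, and z is one step from c: three steps in all.
  have e : f.act (((2 * f.q (n + 1) - l : ℕ) : ℤ), p + p) (f.lift^[l] z) =
      f.act ((f.q (n + 1) : ℤ), p) (f.act ((f.q (n + 1) : ℤ), p) z) := by
    rw [← f.act_natCast_zero, ← f.act_add, ← f.act_add]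
    congr 1
    ext
    · simp only [Prod.fst_add]; omega
    · simp
  rw [e]
  exact (hz.trans (hp z)).trans (hp _)

end MulticriticalCircleMap

/-! ### Arcs of the dynamical partition as projected intervals -/

/-- The image on the circle of the interval `[a, b]`. -/
def circleArc (a b : ℝ) : Set UnitAddCircle := (fun t : ℝ => (t : UnitAddCircle)) '' Set.Icc a b

lemma circleArc_mono {a b a' b' : ℝ} (ha : a' ≤ a) (hb : b ≤ b') :
    circleArc a b ⊆ circleArc a' b' := Set.image_mono (Set.Icc_subset_Icc ha hb)

lemma coe_add_intCast (x : ℝ) (k : ℤ) : ((x + k : ℝ) : UnitAddCircle) = x := by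
  have h : ((k : ℝ) : UnitAddCircle) = 0 := (AddCircle.coe_eq_zero_iff (1 : ℝ)).2 ⟨k, by simp⟩
  rw [AddCircle.coe_add, h, add_zero]

lemma circleArc_add_int (a b : ℝ) (k : ℤ) : circleArc (a + k) (b + k) = circleArc a b := by
  ext z
  constructor
  · rintro ⟨t, ht, rfl⟩
    refine ⟨t - k, ⟨by linarith [ht.1], by linarith [ht.2]⟩, ?_⟩
    have := coe_add_intCast (t - k) k
    rw [sub_add_cancel] at this
    exact this.symm
  · rintro ⟨t, ht, rfl⟩
    exact ⟨t + k, ⟨by linarith [ht.1], by linarith [ht.2]⟩, coe_add_intCast t k⟩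

lemma cIcc_coe {a b : ℝ} (hab : a < b) (hb : b < a + 1) :
    Set.cIcc (a : UnitAddCircle) b = circleArc a b := by
  have hp : (0 : ℝ) < 1 := one_pos
  have eb : toIocMod hp a b = b := (toIocMod_eq_self hp).2 ⟨hab, hb.le⟩
  ext z
  rw [Set.mem_cIcc]
  constructor
  · intro h
    induction z using QuotientAddGroup.induction_on with
    | H t =>
      rw [QuotientAddGroup.btw_coe_iff, eb] at h
      refine ⟨toIcoMod hp a t, ⟨left_le_toIcoMod hp a t, h⟩, ?_⟩
      have : t = toIcoMod hp a t + (toIcoDiv hp a t : ℤ) := by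
        have := toIcoMod_add_toIcoDiv_zsmul hp a t
        simpa using this.symm
      conv_rhs => rw [this]
      exact (coe_add_intCast _ _).symm
  · rintro ⟨t, ht, rfl⟩
    have := (QuotientAddGroup.btw_coe_iff (p := (1 : ℝ)) (x₁ := a) (x₂ := t) (x₃ := b)).2 (by
      rw [eb, (toIcoMod_eq_self hp).2 ⟨ht.1, by linarith [ht.2]⟩]
      exact ht.2)
    exact this

namespace MulticriticalCircleMap

variable (f : MulticriticalCircleMap)

lemma coe_act_natCast (i : ℕ) (p : ℤ) (x : ℝ) :
    ((f.act ((i : ℤ), p) x : ℝ) : UnitAddCircle) = f.iter i x := by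
  rw [act_natCast, coe_add_intCast, iter_coe]

lemma iter_image_circleArc (j : ℕ) (a b : ℝ) :
    f.iter j '' circleArc a b = circleArc (f.lift^[j] a) (f.lift^[j] b) := by
  ext z
  constructor
  · rintro ⟨_, ⟨t, ht, rfl⟩, rfl⟩
    exact ⟨f.lift^[j] t, ⟨(f.strictMono_iterate j).monotone ht.1,
      (f.strictMono_iterate j).monotone ht.2⟩, (f.iter_coe j t).symm⟩
  · rintro ⟨t, ht, rfl⟩
    obtain ⟨s, rfl⟩ := (f.bijective_lift.iterate j).surjective t
    exact ⟨s, ⟨s, ⟨(f.strictMono_iterate j).le_iff_le.1 ht.1,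
      (f.strictMono_iterate j).le_iff_le.1 ht.2⟩, rfl⟩, f.iter_coe j s⟩

lemma iterate_act (j : ℕ) (v : ℤ × ℤ) (x : ℝ) :
    f.lift^[j] (f.act v x) = f.act v (f.lift^[j] x) := by
  rw [← act_natCast_zero, act_comm, act_natCast_zero]

lemma iterate_add_int (j : ℕ) (x : ℝ) (k : ℤ) : f.lift^[j] (x + k) = f.lift^[j] x + k := by
  rw [← f.act_natCast_zero, f.act_add_int, f.act_natCast_zero]

lemma iter_image_circleArc_sigma (j m : ℕ) (y : ℝ) :
    f.iter j '' circleArc y (f.act (f.sigma m) y) =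
      circleArc (f.lift^[j] y) (f.act (f.sigma m) (f.lift^[j] y)) := by
  rw [iter_image_circleArc, iterate_act]

lemma exists_critical_of_deriv_iterate {m : ℕ} {t : ℝ} (h : deriv f.lift^[m] t = 0) :
    ∃ i < m, deriv f.lift (f.lift^[i] t) = 0 := by
  induction m with
  | zero => simp at h
  | succ m ih =>
    have hd : Differentiable ℝ f.lift^[m] := f.differentiable_lift.iterate m
    rw [Function.iterate_succ', deriv_comp _ (f.differentiable_lift _) (hd t), mul_eq_zero] at h
    rcases h with h | h
    · exact ⟨m, m.lt_succ_self, h⟩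
    · obtain ⟨i, hi, h⟩ := ih h
      exact ⟨i, hi.trans m.lt_succ_self, h⟩

lemma eq_sigma_of_even {n : ℕ} (hn : Even n) :
    f.sigma n = ((f.q n : ℤ), (f.sigma n).2) :=
  Prod.ext (by rw [(f.sigma_fst n).1, hn.neg_one_pow, one_mul]) rfl

lemma eq_neg_sigma_of_odd {n : ℕ} (hn : Odd n) :
    -f.sigma n = ((f.q n : ℤ), -(f.sigma n).2) :=
  Prod.ext (by rw [Prod.fst_neg, (f.sigma_fst n).1, hn.neg_one_pow]; ring) rfl

variable {f} (hf : Function.periodicPts f.toHomeomorph = ∅)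

include hf

lemma arcLength_circleArc_sigma (n : ℕ) (y : ℝ) :
    arcLength (circleArc y (f.act (f.sigma n) y)) = f.gap n y :=
  le_antisymm (arcLength_coe_image_Icc_le (lt_act_sigma hf n y).le)
    (le_arcLength_coe_image_Icc (by have := gap_lt_one hf n y; rw [gap] at this; linarith))

lemma I_coe_of_even {n : ℕ} (hn : Even n) (x : ℝ) :
    f.I n (x : UnitAddCircle) = circleArc x (f.act (f.sigma n) x) := by
  have h1 := gap_lt_one hf n x
  rw [gap] at h1
  have hc := cIcc_coe (lt_act_sigma hf n x) (by linarith)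
  have e := f.eq_sigma_of_even hn
  have e2 := f.eq_sigma_of_even (n := n + 2) (by simpa [parity_simps] using hn)
  have hq : f.iter (f.q n) (x : UnitAddCircle) = (f.act (f.sigma n) x : ℝ) := by
    rw [e, coe_act_natCast]
  have hq2 : f.iter (f.q (n + 2)) (x : UnitAddCircle) = (f.act (f.sigma (n + 2)) x : ℝ) := by
    rw [e2, coe_act_natCast]
  rw [I, hq, hq2, hc, if_pos]
  exact ⟨_, ⟨(lt_act_sigma hf (n + 2) x).le, (f.act_lt_act ((theta_sigma_succ_lt hf (n + 1)).trans
    (theta_sigma_succ_lt hf n)) x).le⟩, rfl⟩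

lemma I_coe_of_odd {n : ℕ} (hn : Odd n) (x : ℝ) :
    f.I n (x : UnitAddCircle) = circleArc (f.act (-f.sigma n) x) x := by
  have h1 := gap_lt_one hf n (f.act (-f.sigma n) x)
  rw [gap, f.act_act_neg] at h1
  have h2 := act_neg_sigma_lt hf n x
  have hc := cIcc_coe h2 (by linarith)
  have hc2 : Set.cIcc (x : UnitAddCircle) (f.act (-f.sigma n) x : ℝ) =
      circleArc x (f.act (-f.sigma n) x + 1) := by
    have := coe_add_intCast (f.act (-f.sigma n) x) 1
    push_cast at this
    rw [← this]
    exact cIcc_coe (by linarith) (by linarith)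
  have e := f.eq_neg_sigma_of_odd hn
  have e2 := f.eq_neg_sigma_of_odd (n := n + 2) (by simpa [parity_simps] using hn)
  have hq : f.iter (f.q n) (x : UnitAddCircle) = (f.act (-f.sigma n) x : ℝ) := by
    rw [e, coe_act_natCast]
  have hq2 : f.iter (f.q (n + 2)) (x : UnitAddCircle) = (f.act (-f.sigma (n + 2)) x : ℝ) := by
    rw [e2, coe_act_natCast]
  rw [I, hq, hq2, hc2, if_neg, hc]
  -- For odd n the orbit point f^{qₙ₊₂}(x) lies just left of x. A representative of it in the
  -- complementary arc would differ by an integer strictly between -1 and 0.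
  rintro ⟨t, ht, hts⟩
  obtain ⟨k, hk⟩ := exists_int_of_coe_eq hts
  have h3 := act_neg_sigma_lt hf (n + 2) x
  have h4 : f.act (-f.sigma n) x < f.act (-f.sigma (n + 2)) x := by
    refine f.act_lt_act ?_ x
    rw [theta_neg, theta_neg]
    linarith [theta_sigma_succ_lt hf n, theta_sigma_succ_lt hf (n + 1)]
  have h5 : (0 : ℝ) > k := by linarith [ht.1]
  have h6 : (-1 : ℝ) < k := by linarith [ht.2]
  have h7 : (0 : ℤ) > k := by exact_mod_cast h5
  have h8 : (-1 : ℤ) < k := by exact_mod_cast h6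
  omega

omit hf in
lemma Delta_coe_eq {n : ℕ} {c z : ℝ} {u v : ℤ × ℤ} (hu : u.1 = f.q n) (hv : v.1 = f.q (n + 1))
    (hI : f.I (n + 1) (c : UnitAddCircle) = circleArc z (f.act (f.sigma (n + 1)) z)) (k : ℕ) :
    f.Delta n (c : UnitAddCircle) k = circleArc (f.act (u + k • v) z)
      (f.act (f.sigma (n + 1)) (f.act (u + k • v) z)) := by
  have e : u + k • v = (((f.q n + k * f.q (n + 1) : ℕ) : ℤ), (u + k • v).2) :=
    Prod.ext (by simp [hu, hv]) rfl
  rw [Delta, hI, iter_image_circleArc_sigma, e, act_natCast, act_add_int, circleArc_add_int]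

/-- The arcs `Δ_k` as images of fundamental intervals of level `n + 1`. -/
lemma exists_Delta_eq (n : ℕ) (c : ℝ) : ∃ y : ℕ → ℝ,
    (∀ k, f.Delta n (c : UnitAddCircle) k =
      circleArc (y k) (f.act (f.sigma (n + 1)) (y k))) ∧
    (∀ k, f.Near 1 (n + 1) (y k) (y (k + 1))) ∧
    (∀ k < f.a (n + 1), f.act (-f.sigma n) c ≤ y k ∧
      f.act (f.sigma (n + 1)) (y k) ≤ f.act (f.sigma n) c) ∧
    ∃ z, ∃ p : ℤ, f.Near 1 (n + 1) c z ∧ y 0 = f.lift^[f.q n] z + p := by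
  have h0 := theta_sigma_pos hf n
  have h1 := theta_sigma_pos hf (n + 1)
  have h2 : 0 < f.theta (f.sigma n) - f.a (n + 1) * f.theta (f.sigma (n + 1)) := by
    have := theta_sigma_pos hf (n + 2)
    rw [sigma, theta_sub, theta_zsmul] at this
    push_cast at this; exact this
  -- Positivity of the displacement of σₙ₊₂ leaves room for all a_{n+1} steps of level n + 1 inside
  -- one step of level n.
  have hk : ∀ k : ℕ, k < f.a (n + 1) → ((k : ℝ) + 1) * f.theta (f.sigma (n + 1)) <
      f.theta (f.sigma n) := by
    intro k hk
    have : (k : ℝ) + 1 ≤ f.a (n + 1) := by exact_mod_cast hk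
    nlinarith
  rcases Nat.even_or_odd n with hn | hn
  · have hu := f.eq_sigma_of_even hn
    have hv := f.eq_neg_sigma_of_odd hn.add_one
    refine ⟨fun k => f.act (f.sigma n + k • (-f.sigma (n + 1))) (f.act (-f.sigma (n + 1)) c),
      Delta_coe_eq (by rw [hu]) (by rw [hv])
        (by rw [I_coe_of_odd hf hn.add_one, f.act_act_neg]), fun k => ?_, fun k hka => ?_,
      f.act (-f.sigma (n + 1)) c, (f.sigma n).2, near_act_neg_sigma hf _ _, ?_⟩
    · dsimp only
      rw [show f.sigma n + (k + 1) • (-f.sigma (n + 1)) =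
        -f.sigma (n + 1) + (f.sigma n + k • (-f.sigma (n + 1))) by rw [succ_nsmul]; abel,
        f.act_add (-f.sigma (n + 1))]
      exact near_act_neg_sigma hf _ _
    · have := hk k hka
      dsimp only
      rw [← f.act_add, ← f.act_add]
      constructor <;>
      · refine act_le_act hf ?_ c
        simp only [theta_add, theta_neg, theta_nsmul]
        nlinarith
    · dsimp only
      rw [zero_smul, add_zero, hu, act_natCast]
  · have hu := f.eq_neg_sigma_of_odd hn
    have hv := f.eq_sigma_of_even hn.add_one
    refine ⟨fun k => f.act (-f.sigma n + k • f.sigma (n + 1)) c,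
      Delta_coe_eq (by rw [hu]) (by rw [hv])
        (by rw [I_coe_of_even hf hn.add_one]), fun k => ?_, fun k hka => ?_,
      c, -(f.sigma n).2, near_one_of_mem hf le_rfl (lt_act_sigma hf _ _).le, ?_⟩
    · dsimp only
      rw [show -f.sigma n + (k + 1) • f.sigma (n + 1) =
        f.sigma (n + 1) + (-f.sigma n + k • f.sigma (n + 1)) by rw [succ_nsmul]; abel,
        f.act_add (f.sigma (n + 1))]
      exact near_act_sigma hf _ _
    · have := hk k hka
      have hk0 : (0 : ℝ) ≤ k * f.theta (f.sigma (n + 1)) := by positivity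
      dsimp only
      rw [← f.act_add]
      constructor <;>
      · refine act_le_act hf ?_ c
        simp only [theta_add, theta_neg, theta_nsmul]
        nlinarith
    · dsimp only
      rw [zero_smul, add_zero, hu, act_natCast]

/-! ### Atoms of the auxiliary partition -/

omit hf in
/-- A set on the circle that lies in two adjacent fundamental intervals of level `n`, and whose
length is comparable to theirs. -/
def IsLargeAtom (f : MulticriticalCircleMap) (C : ℝ) (n : ℕ) (A : Set UnitAddCircle) : Prop :=
  ∃ x, A ⊆ circleArc (f.act (-f.sigma n) x) (f.act (f.sigma n) x) ∧ f.gap n x ≤ C * arcLength A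

omit hf in
lemma IsLargeAtom.mono {C C' : ℝ} {n : ℕ} {A : Set UnitAddCircle} (h : IsLargeAtom f C n A)
    (hC : C ≤ C') : IsLargeAtom f C' n A := by
  obtain ⟨x, hx, hg⟩ := h
  exact ⟨x, hx, hg.trans (mul_le_mul_of_nonneg_right hC ENNReal.toReal_nonneg)⟩

/-- Each base point is at most one step of level n from the common point, up to an integer
translation, so the gaps at the two base points are comparable. The length of `B` is at most that of
its two enclosing intervals. -/
lemma exists_arcLength_le : ∃ D ≥ 1, ∀ C n A B, IsLargeAtom f C n A → IsLargeAtom f C n B →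
    (A ∩ B).Nonempty → arcLength B ≤ D * C * arcLength A := by
  obtain ⟨C₁, hC₁, h1⟩ := exists_gap_le_of_near hf 1
  obtain ⟨C₂, hC₂, h2⟩ := exists_gap_le_of_near hf 2
  refine ⟨(1 + C₁) * C₂, one_le_mul_of_one_le_of_one_le (by linarith) hC₂, ?_⟩
  rintro C n A B ⟨x, hA, hx⟩ ⟨y, hB, -⟩ ⟨z, hzA, hzB⟩
  obtain ⟨s, hs, rfl⟩ := hA hzA
  obtain ⟨t, ht, hst⟩ := hB hzB
  obtain ⟨k, hk⟩ := exists_int_of_coe_eq hst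
  have hnear : f.Near 2 n x (y + k) := by
    have n1 : f.Near 1 n x s := near_one_of_mem_Icc hs
    have n2 : f.Near 1 n (y + k) s := by
      refine near_one_of_mem_Icc ?_
      rw [hk, f.act_add_int, f.act_add_int]
      exact ⟨add_le_add_left ht.1 _, add_le_add_left ht.2 _⟩
    exact n1.trans n2.symm
  have g1 : f.gap n y ≤ C₂ * f.gap n x := by
    have := h2 n _ _ hnear
    rwa [f.gap_add_int] at this
  have g2 := h1 n _ _ (near_act_neg_sigma hf n y)
  calc arcLength B ≤ f.act (f.sigma n) y - f.act (-f.sigma n) y :=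
        (arcLength_mono hB).trans (arcLength_coe_image_Icc_le
          ((act_neg_sigma_lt hf n y).trans (lt_act_sigma hf n y)).le)
    _ = f.gap n y + f.gap n (f.act (-f.sigma n) y) := by
        simp only [gap, f.act_act_neg]; ring
    _ ≤ (1 + C₁) * f.gap n y := by linarith
    _ ≤ (1 + C₁) * (C₂ * (C * arcLength A)) := by
        refine mul_le_mul_of_nonneg_left (g1.trans ?_) (by linarith)
        exact mul_le_mul_of_nonneg_left hx (by linarith)
    _ = _ := by ring

lemma isLargeAtom_circleArc_sigma {C : ℝ} {n : ℕ} {w : ℝ}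
    (h : f.gap n w ≤ C * f.gap (n + 1) w) :
    IsLargeAtom f C n (circleArc w (f.act (f.sigma (n + 1)) w)) := by
  refine ⟨w, circleArc_mono (act_neg_sigma_lt hf n w).le
    (f.act_lt_act (theta_sigma_succ_lt hf n) w).le, ?_⟩
  rwa [arcLength_circleArc_sigma hf]

/-- The arc `I_m` is a fundamental interval of level `m`. -/
lemma exists_I_eq (m : ℕ) (c : ℝ) : ∃ z,
    f.I m (c : UnitAddCircle) = circleArc z (f.act (f.sigma m) z) ∧ f.Near 1 m c z := by
  rcases Nat.even_or_odd m with h | h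
  · exact ⟨c, I_coe_of_even hf h c, near_one_of_mem hf le_rfl (lt_act_sigma hf _ _).le⟩
  · exact ⟨f.act (-f.sigma m) c, by rw [I_coe_of_odd hf h, f.act_act_neg],
      near_act_neg_sigma hf m c⟩

/-- At critical times, the fundamental intervals of levels `n` and `n + 1` are comparable. -/
lemma exists_gap_le_of_mem_criticalTimes : ∃ C ≥ 1, ∀ n c, deriv f.lift c = 0 → ∀ y : ℕ → ℝ,
    (∀ k, f.Delta n (c : UnitAddCircle) k = circleArc (y k) (f.act (f.sigma (n + 1)) (y k))) →
    (∃ z, ∃ p : ℤ, f.Near 1 (n + 1) c z ∧ y 0 = f.lift^[f.q n] z + p) →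
    ∀ k ∈ f.criticalTimes n (c : UnitAddCircle), ∀ j < f.q (n + 1),
      f.gap n (f.lift^[j] (y k)) ≤ C * f.gap (n + 1) (f.lift^[j] (y k)) := by
  obtain ⟨C₁, hC₁, h1⟩ := exists_gap_le_gap_succ_of_orbit hf
  obtain ⟨C₂, hC₂, h2⟩ := exists_gap_le_gap_succ_of_near_critical hf
  refine ⟨max C₁ C₂, le_max_of_le_left hC₁, fun n c hc y hy hz k hk j hj => ?_⟩
  have hpos := gap_pos hf (n + 1) (f.lift^[j] (y k))
  rcases hk.2 with rfl | ⟨P, hP, t', ht', hcrit⟩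
  · obtain ⟨z, p, hz, hy0⟩ := hz
    have hq := q_le_q_succ hf n
    -- The index 0 counts as critical by convention, so no critical point of the return map need lie
    -- in Δ_0. Instead its image is the (j + qₙ)-th image of an interval at c, and j + qₙ ≤ 2qₙ₊₁.
    have := h1 n c hc (j + f.q n) (by omega) z hz
    rw [hy0, iterate_add_int, gap_add_int, gap_add_int, ← Function.iterate_add_apply]
    exact this.trans (mul_le_mul_of_nonneg_right (le_max_left _ _) (gap_pos hf _ _).le)
  · rw [hy] at hP
    obtain ⟨t, ht, rfl⟩ := hP
    obtain ⟨m, hm, hcm⟩ := f.exists_critical_of_deriv_iterate hcrit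
    obtain ⟨l, rfl⟩ := exists_int_of_coe_eq ht'
    have hcm' : deriv f.lift (f.lift^[m] (t' + l)) = 0 := by
      rw [iterate_add_int, deriv_lift_add_int, hcm]
    obtain ⟨p, hp⟩ := exists_near_act_q hf (n + 1)
    -- The critical time m may be smaller than j. Going on to qₙ₊₁ + m keeps the number of iterates
    -- nonnegative and costs one more step of level n + 1.
    have e : f.act (((f.q (n + 1) + m - j : ℕ) : ℤ), p) (f.lift^[j] (y k)) =
        f.act ((f.q (n + 1) : ℤ), p) (f.lift^[m] (y k)) := by
      rw [← f.act_natCast_zero, ← f.act_natCast_zero, ← f.act_add, ← f.act_add]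
      congr 1
      ext
      · simp only [Prod.fst_add]; omega
      · simp
    have hnear : f.Near 2 (n + 1) (f.lift^[m] (t' + l))
        (f.act ((f.q (n + 1) : ℤ), p) (f.lift^[m] (y k))) :=
      ((near_one_of_mem hf ht.1 ht.2).symm.iterate m).trans (hp _)
    refine (h2 n _ hcm' (f.q (n + 1) + m - j) (by omega) p _ ?_).trans
      (mul_le_mul_of_nonneg_right (le_max_right _ _) hpos.le)
    rw [e]
    exact hnear.mono hf (by norm_num)

/-- All atoms of the auxiliary partitions are comparable to the fundamental intervals around
them. -/
lemma exists_isLargeAtom : ∃ C ≥ 1, ∀ n (c : ℝ), deriv f.lift c = 0 →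
    ∀ A ∈ f.auxPartition n (c : UnitAddCircle), IsLargeAtom f C n A := by
  obtain ⟨C₁, hC₁, h1⟩ := exists_gap_le_gap_succ_of_orbit hf
  obtain ⟨C₂, hC₂, h2⟩ := exists_gap_le_of_mem_criticalTimes hf
  obtain ⟨C₃, hC₃, h3⟩ := exists_gap_le_of_near hf 1
  have k1 : C₂ ≤ C₃ * C₂ * C₃ := by
    have : C₂ * 1 ≤ C₂ * (C₃ * C₃) := mul_le_mul_of_nonneg_left
      (one_le_mul_of_one_le_of_one_le hC₃ hC₃) (by linarith)
    linarith
  have k2 : C₁ ≤ C₁ * C₁ := by nlinarith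
  refine ⟨max (C₃ * C₂ * C₃) (C₁ * C₁), le_max_of_le_right (by nlinarith),
    fun n c hc A hA => ?_⟩
  obtain ⟨y, hy, hy1, hya, hyz⟩ := exists_Delta_eq hf n c
  have hq := q_le_q_succ hf (n + 1)
  rcases hA with ((⟨j, hj, B, ⟨k, hk, rfl⟩, rfl⟩ | ⟨j, hj, B, ⟨hBne, k, hk, k', hk', -, -, rfl⟩,
    rfl⟩) | ⟨j, hj, rfl⟩) | ⟨l, hl, rfl⟩
  · rw [hy, iter_image_circleArc_sigma]
    exact (isLargeAtom_circleArc_sigma hf (h2 n c hc y hy hyz k hk j hj)).mono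
      (k1.trans (le_max_left _ _))
  · have hk'a : k' ≤ f.a (n + 1) := by
      rcases hk' with h | h
      · exact h.1.le
      · exact h.le
    obtain ⟨_, hP⟩ := hBne
    obtain ⟨m, hm, -⟩ := Set.mem_iUnion₂.1 hP
    have hkk' : k + 1 < k' := by have := hm.1; have := hm.2; omega
    refine IsLargeAtom.mono (C := C₃ * C₂ * C₃) ⟨f.lift^[j] c, ?_, ?_⟩ (le_max_left _ _)
    · rw [Set.image_iUnion₂]
      refine Set.iUnion₂_subset fun m hm => ?_
      rw [hy, iter_image_circleArc_sigma]
      obtain ⟨ha, hb⟩ := hya m (hm.2.trans_le hk'a)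
      refine circleArc_mono ?_ ?_
      · rw [← iterate_act]; exact (f.strictMono_iterate j).monotone ha
      · rw [← iterate_act, ← iterate_act]; exact (f.strictMono_iterate j).monotone hb
    -- A nonempty bridge contains Δ_{k+1}, which is one step of level n + 1 from the critical spot
    -- Δ_k. This single arc already gives the lower bound for the length.
    · have hsub : circleArc (f.lift^[j] (y (k + 1)))
          (f.act (f.sigma (n + 1)) (f.lift^[j] (y (k + 1)))) ⊆
          f.iter j '' ⋃ m ∈ Set.Ioo k k', f.Delta n (c : UnitAddCircle) m := by
        rw [← iter_image_circleArc_sigma, ← hy]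
        exact Set.image_mono (Set.subset_biUnion_of_mem (u := fun m => f.Delta n _ m)
          ⟨k.lt_succ_self, hkk'⟩)
      have hlen := arcLength_mono hsub
      rw [arcLength_circleArc_sigma hf] at hlen
      obtain ⟨ha, hb⟩ := hya k hk.1
      have hnear : f.Near 1 n c (y k) :=
        near_one_of_mem_Icc ⟨ha, (lt_act_sigma hf (n + 1) _).le.trans hb⟩
      have g1 := h3 n _ _ (hnear.iterate j).symm
      have g2 := h2 n c hc y hy hyz k hk j hj
      have g3 := h3 (n + 1) _ _ ((hy1 k).iterate j).symm
      calc f.gap n (f.lift^[j] c) ≤ C₃ * f.gap n (f.lift^[j] (y k)) := g1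
        _ ≤ C₃ * (C₂ * (C₃ * f.gap (n + 1) (f.lift^[j] (y (k + 1))))) := by
            gcongr; exact g2.trans (by gcongr)
        _ = C₃ * C₂ * C₃ * f.gap (n + 1) (f.lift^[j] (y (k + 1))) := by ring
        _ ≤ _ := by gcongr
  · obtain ⟨z, hz, hcz⟩ := exists_I_eq hf (n + 2) c
    rw [hz, iter_image_circleArc_sigma]
    refine IsLargeAtom.mono (C := C₁ * C₁) ⟨f.lift^[j] z, ?_, ?_⟩ (le_max_right _ _)
    · exact circleArc_mono (act_neg_sigma_lt hf n _).le
        (f.act_lt_act ((theta_sigma_succ_lt hf (n + 1)).trans (theta_sigma_succ_lt hf n)) _).le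
    · rw [arcLength_circleArc_sigma hf]
      -- The atom has level n + 2, so the comparison of consecutive levels is used twice.
      have g1 := h1 n c hc j (by omega) z (hcz.of_succ hf)
      have g2 := h1 (n + 1) c hc j (by omega) z hcz
      calc _ ≤ _ := g1
        _ ≤ C₁ * (C₁ * f.gap (n + 2) (f.lift^[j] z)) := by gcongr
        _ = _ := by ring
  · obtain ⟨z, hz, hcz⟩ := exists_I_eq hf (n + 1) c
    rw [hz, iter_image_circleArc_sigma]
    have hq' := q_le_q_succ hf n
    exact (isLargeAtom_circleArc_sigma hf (h1 n c hc l (by omega) z hcz)).mono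
      (k2.trans (le_max_right _ _))

end MulticriticalCircleMap

end

theorem mainTheorem8 (f : MulticriticalCircleMap)
    (hf : Function.periodicPts f.toHomeomorph = ∅) :
    ∃ K : ℝ, 1 < K ∧
      ∀ c₀ : UnitAddCircle, IsCircleCritical f.lift c₀ →
        ∀ n : ℕ, 1 ≤ n →
          ∀ A ∈ f.auxPartition n c₀, ∀ B ∈ f.auxPartition n c₀, ConsecutiveAtoms A B →
            K⁻¹ * arcLength B ≤ arcLength A ∧ arcLength A ≤ K * arcLength B := by
  obtain ⟨C, hC, hlarge⟩ := MulticriticalCircleMap.exists_isLargeAtom hf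
  obtain ⟨D, hD, hle⟩ := MulticriticalCircleMap.exists_arcLength_le hf
  have hDC : 1 ≤ D * C := one_le_mul_of_one_le_of_one_le hD hC
  -- The summand 1 makes the constant strictly larger than 1.
  refine ⟨D * C + 1, by linarith, ?_⟩
  rintro _ ⟨c, rfl, hc⟩ n - A hA B hB ⟨-, hAB⟩
  have hA' := hlarge n c hc A hA
  have hB' := hlarge n c hc B hB
  have h1 := hle C n A B hA' hB' hAB
  have h2 := hle C n B A hB' hA' (by rwa [Set.inter_comm])
  have h3 : 0 ≤ arcLength A := ENNReal.toReal_nonneg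
  have h4 : 0 ≤ arcLength B := ENNReal.toReal_nonneg
  constructor
  · rw [inv_mul_le_iff₀ (by linarith)]; linarith
  · linarith
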